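/- Let $\mathring{\mathfrak g}$ be a finite-dimensional simple complex Lie algebra with Cartan subalgebra $\mathring{\mathfrak h}$, root system $\mathring R$, simple roots $\alpha_1,\dots,\alpha_n$ and highest root $\theta$, and let $\mathfrak g=\mathring{\mathfrak g}\otimes\mathbb C[t^{\pm1}]\oplus\mathbb Cc\oplus\mathbb Cd$ be the untwisted affine Kac–Moody algebra, with bracket $$[x\otimes t^r+a_1c+b_1d,\;y\otimes t^s+a_2c+b_2d]=[x,y]\otimes t^{r+s}+b_1s\,(y\otimes t^s)-b_2r\,(x\otimes t^r)+r\,\delta_{r,-s}\,(x,y)\,c ,$$ where $(\cdot,\cdot)$ is the normalized invariant form. Put $\alpha_0=\delta-\theta$ and $I=\{0,1,\dots,n\}$. Let $J\subsetneq I$ be a proper (possibly empty) subset and let $\mathfrak p_J\subseteq\mathfrak g$ be the subalgebra generated by the standard Borel subalgebra $(\mathring{\mathfrak g}\otimes t\mathbb C[t])\oplus(\mathring{\mathfrak b}\otimes1)\oplus\mathbb Cc\oplus\mathbb Cd$ and the root spaces $\mathfrak g_{-\alpha_i}$, $i\in J$. Let $\tilde{\mathfrak p}_J$ be the Lie algebra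 $\mathfrak p_J\cap[\mathfrak g,\mathfrak g]$ modulo its center. For $\gamma=\sum_{i\in I}\mathbf a_i(\gamma)\alpha_i$ in the affine root lattice set $\operatorname{gr}_J(\gamma)=\sum_{i\notin J}\mathbf a_i(\gamma)$, and give (the classes of) the weight vectors of weight $\gamma$ in $\tilde{\mathfrak p}_J$ the grade $\operatorname{gr}_J(\gamma)$. Let $m=\operatorname{gr}_J(\delta)$, let $\xi$ be a primitive $m$-th root of unity, and let $s_i=0$ if $i\in J$ and $s_i=1$ if $i\in I\setminus J$. Then: (1) $m>0$, and there is exactly one automorphism $\sigma$ of the Lie algebra $\mathring{\mathfrak g}$ that acts on $\mathring{\mathfrak g}_{\alpha_i}$ as $\xi^{s_i}$ for $1\le i\le n$ and on $\mathring{\mathfrak g}_{-\theta}$ as $\xi^{s_0}$; its order is $m$. (2) Extend $\sigma$ to $\mathring{\mathfrak g}[t]=\mathring{\mathfrak g}\otimes\mathbb C[t]$ by $\sigma(x\otimes t^r)=\xi^{-r}\sigma(x)\otimes t^r$. The grades above make $\tilde{\mathfrak p}_J$ a $\mathbb Z_{\ge0}$-graded Lie algebra, and the powers of $t$ make the fixed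 point algebra $\mathring{\mathfrak g}[t]^\sigma$ a $\mathbb Z_{\ge0}$-graded Lie algebra. (3) There is a graded Lie algebra isomorphism $\varphi:\tilde{\mathfrak p}_J\to\mathring{\mathfrak g}[t]^\sigma$ (it maps the component of grade $k$ onto the component of degree $k$, for every $k\ge 0$) such that, for every root $\beta\in\mathring R$, every nonzero $x\in\mathring{\mathfrak g}_\beta$ (in particular for the vectors $x_\alpha^{\pm}$, $\alpha\in\mathring R^+$, of a Chevalley basis, with $\beta=\pm\alpha$) and every $r\in\mathbb Z$ with $x\otimes t^r\in\mathfrak p_J$, one has $\operatorname{gr}_J(\beta+r\delta)\ge0$ and $$\varphi(x\otimes t^r)=x\otimes t^{\operatorname{gr}_J(\beta+r\delta)} ;$$ likewise, for nonzero $h\in\mathring{\mathfrak h}$ and $r\in\mathbb Z$ with $h\otimes t^r\in\mathfrak p_J$, one has $rm\ge 0$ and $\varphi(h\otimes t^r)=h\otimes t^{rm}$. It is the only Lie algebra isomorphism $\tilde{\mathfrak p}_J\to\mathring{\mathfrak g}[t]^\sigma$ with these values on the root vectors $x\otimes t^r$, $x\in\mathring{\mathfrak g}_\beta$, $\beta\in\mathring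 R$. (4) If $|J|=n$, then $\mathfrak p_J\cap[\mathfrak g,\mathfrak g]=[\mathfrak p_J,\mathfrak p_J]+\mathbb Cc$. -/

import Mathlib

open scoped TensorProduct LaurentPolynomial Polynomial
open LieAlgebra LieModule

noncomputable section

namespace AffineParabolic

/-! ### The loop algebra -/

section Loop

variable {L : Type*} [LieRing L] [LieAlgebra ℂ L]

variable (L) in
/-- The loop algebra `L ⊗ ℂ[t, t⁻¹]` (the Laurent polynomials are the left factor). -/
def Loop : Type _ := ℂ[T;T⁻¹] ⊗[ℂ] L

instance : LieRing (Loop L) := ExtendScalars.instLieRing ℂ ℂ[T;T⁻¹] L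

instance : LieAlgebra ℂ (Loop L) := ExtendScalars.instBaseLieAlgebra ℂ ℂ[T;T⁻¹] L

/-- The element `x ⊗ t ^ r` of the loop algebra. -/
def loopElt (r : ℤ) : L →ₗ[ℂ] Loop L :=
  TensorProduct.mk ℂ ℂ[T;T⁻¹] L (LaurentPolynomial.T r)

variable (L) in
/-- The degree derivation `t d/dt` of the loop algebra. -/
def loopDeriv : Loop L →ₗ[ℂ] Loop L :=
  LinearMap.rTensor L ((AddMonoidAlgebra.basis ℤ ℂ).constr ℂ
    (fun r : ℤ => (r : ℂ) • (LaurentPolynomial.T r : ℂ[T;T⁻¹])))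

/-- For a bilinear form `Φ` on `L`, the bilinear form on the loop algebra with
`(x ⊗ t ^ r, y ⊗ t ^ s) ↦ r δ_{r,-s} Φ(x, y)` for symmetric `Φ`. -/
def loopCocycle (Φ : LinearMap.BilinForm ℂ L) : LinearMap.BilinForm ℂ (Loop L) :=
  (LoopAlgebra.residuePairing ℂ ℤ L Φ).flip

theorem loop_induction {p : Loop L → Prop} (f : Loop L)
    (elt : ∀ r x, p (loopElt r x)) (add : ∀ f g, p f → p g → p (f + g)) : p f := by
  have zero : p 0 := by simpa using elt 0 0
  induction f using TensorProduct.induction_on with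
  | zero => exact zero
  | add f g hf hg => exact add f g hf hg
  | tmul a x =>
    induction a using LaurentPolynomial.induction_on' with
    | add a b ha hb => rw [TensorProduct.add_tmul]; exact add _ _ ha hb
    | C_mul_T r a =>
      have : ((LaurentPolynomial.C a * LaurentPolynomial.T r : ℂ[T;T⁻¹]) ⊗ₜ[ℂ] x : Loop L)
          = loopElt r (a • x) := by
        rw [← LaurentPolynomial.smul_eq_C_mul, TensorProduct.smul_tmul]; rfl
      rw [this]; exact elt _ _

@[simp] theorem lie_loopElt (r s : ℤ) (x y : L) :
    ⁅loopElt r x, loopElt s y⁆ = loopElt (r + s) ⁅x, y⁆ := by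
  refine (ExtendScalars.bracket_tmul ℂ ℂ[T;T⁻¹] L L _ _ x y).trans ?_
  rw [← LaurentPolynomial.T_add]; rfl

@[simp] theorem loopDeriv_loopElt (r : ℤ) (x : L) :
    loopDeriv L (loopElt r x) = (r : ℂ) • loopElt r x := by
  have : (AddMonoidAlgebra.basis ℤ ℂ).constr ℂ
      (fun r : ℤ => (r : ℂ) • (LaurentPolynomial.T r : ℂ[T;T⁻¹])) (LaurentPolynomial.T r)
      = (r : ℂ) • LaurentPolynomial.T r := by
    have h : (LaurentPolynomial.T r : ℂ[T;T⁻¹]) = AddMonoidAlgebra.basis ℤ ℂ r := by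
      rw [AddMonoidAlgebra.basis_apply]; rfl
    conv_lhs => rw [h]
    rw [Module.Basis.constr_basis]
  change LinearMap.rTensor L _ (LaurentPolynomial.T r ⊗ₜ[ℂ] x) =
    ((r : ℂ) • (LaurentPolynomial.T r ⊗ₜ[ℂ] x : ℂ[T;T⁻¹] ⊗[ℂ] L))
  rw [LinearMap.rTensor_tmul, this, TensorProduct.smul_tmul']

theorem loopCocycle_loopElt (Φ : LinearMap.BilinForm ℂ L) (hs : Φ.IsSymm) (r s : ℤ) (x y : L) :
    loopCocycle Φ (loopElt r x) (loopElt s y) = if r + s = 0 then (r : ℂ) * Φ x y else 0 := by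
  let u (r : ℤ) (x : L) : loopAlgebra ℂ ℤ L := AddMonoidAlgebra.single r 1 ⊗ₜ[ℂ] x
  change LoopAlgebra.residuePairing ℂ ℤ L Φ (u s y) (u r x) = _
  rw [LoopAlgebra.residuePairing_apply_apply, LoopAlgebra.toFinsupp_single_tmul,
    LoopAlgebra.toFinsupp_single_tmul, Finsupp.sum_single_index (by simp)]
  by_cases hrs : r + s = 0
  · have : s = -r := by omega
    subst this
    simp [hs.eq y x]
  · rw [if_neg hrs, Finsupp.single_eq_of_ne (by omega)]
    simp

theorem loopDeriv_lie (f g : Loop L) :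
    loopDeriv L ⁅f, g⁆ = ⁅loopDeriv L f, g⁆ + ⁅f, loopDeriv L g⁆ := by
  induction f using loop_induction with
  | add f f' hf hf' => simp only [add_lie, map_add, hf, hf']; abel
  | elt r x =>
    induction g using loop_induction with
    | add g g' hg hg' => simp only [lie_add, map_add, hg, hg']; abel
    | elt s y => simp [add_smul]

theorem loopCocycle_self (Φ : LinearMap.BilinForm ℂ L) (hs : Φ.IsSymm) (f : Loop L) :
    loopCocycle Φ f f = 0 := by
  have h := (LoopAlgebra.twoCochainOfBilinear ℂ ℤ L Φ hs).2
  rw [Cohomology.mem_twoCochain_iff] at h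
  have h' := h f
  exact h'

theorem loopCocycle_skew (Φ : LinearMap.BilinForm ℂ L) (hs : Φ.IsSymm) (f g : Loop L) :
    loopCocycle Φ f g = -loopCocycle Φ g f := by
  have h := loopCocycle_self Φ hs (f + g)
  simp only [map_add, LinearMap.add_apply, loopCocycle_self Φ hs, zero_add, add_zero] at h
  exact eq_neg_of_add_eq_zero_right h

theorem loopCocycle_deriv (Φ : LinearMap.BilinForm ℂ L) (hs : Φ.IsSymm) (f g : Loop L) :
    loopCocycle Φ (loopDeriv L f) g + loopCocycle Φ f (loopDeriv L g) = 0 := by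
  induction f using loop_induction with
  | add f f' hf hf' =>
    simp only [map_add, LinearMap.add_apply]
    linear_combination hf + hf'
  | elt r x =>
    induction g using loop_induction with
    | add g g' hg hg' =>
      simp only [map_add]
      linear_combination hg + hg'
    | elt s y =>
      simp only [loopDeriv_loopElt, map_smul, LinearMap.smul_apply, loopCocycle_loopElt Φ hs,
        smul_eq_mul]
      split_ifs with h
      · have : (r : ℂ) + s = 0 := by exact_mod_cast h
        linear_combination (r : ℂ) * Φ x y * this
      · simp

theorem loopCocycle_jacobi (Φ : LinearMap.BilinForm ℂ L) (hs : Φ.IsSymm) (hi : Φ.lieInvariant L)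
    (f g k : Loop L) :
    loopCocycle Φ f ⁅g, k⁆ = loopCocycle Φ ⁅f, g⁆ k + loopCocycle Φ g ⁅f, k⁆ := by
  induction f using loop_induction with
  | add f f' hf hf' =>
    simp only [map_add, LinearMap.add_apply, add_lie]
    linear_combination hf + hf'
  | elt r x =>
    induction g using loop_induction with
    | add g g' hg hg' =>
      simp only [map_add, LinearMap.add_apply, add_lie, lie_add]
      linear_combination hg + hg'
    | elt s y =>
      induction k using loop_induction with
      | add k k' hk hk' =>
        simp only [map_add, lie_add]
        linear_combination hk + hk'
      | elt u z =>
        simp only [lie_loopElt, loopCocycle_loopElt Φ hs]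
        have e1 : r + (s + u) = 0 ↔ r + s + u = 0 := by constructor <;> intro h <;> omega
        have e2 : s + (r + u) = 0 ↔ r + s + u = 0 := by constructor <;> intro h <;> omega
        simp only [e1, e2]
        split_ifs with h
        · have h1 : Φ ⁅x, y⁆ z = -Φ y ⁅x, z⁆ := hi x y z
          have h2 : Φ ⁅y, x⁆ z = -Φ x ⁅y, z⁆ := hi y x z
          rw [← lie_skew, map_neg, LinearMap.neg_apply] at h2
          push_cast
          linear_combination (r : ℂ) * h2 - (s : ℂ) * h1
        · simp

end Loop

/-! ### The affine Lie algebra -/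

section Affine

variable {L : Type*} [LieRing L] [LieAlgebra ℂ L] [FiniteDimensional ℂ L] [IsSimple ℂ L]
  {H : LieSubalgebra ℂ L} [H.IsCartanSubalgebra]

/-- The normalized invariant form on a simple Lie algebra with highest root `θ`: the multiple of
the Killing form for which `(θ^∨, θ^∨) = 2`; equivalently, the induced form on the dual of the
Cartan subalgebra satisfies `(θ, θ) = 2`. -/
def normalizedForm (θ : H.root) : LinearMap.BilinForm ℂ L :=
  (2 / killingForm ℂ L (IsKilling.coroot (θ : Weight ℂ H L) : H)
    (IsKilling.coroot (θ : Weight ℂ H L) : H)) • killingForm ℂ L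

theorem normalizedForm_isSymm (θ : H.root) : (normalizedForm θ).IsSymm :=
  ⟨fun x y => by
    simp only [normalizedForm, LinearMap.smul_apply,
      LieModule.traceForm_comm ℂ L L x y]⟩

theorem normalizedForm_lieInvariant (θ : H.root) : (normalizedForm θ).lieInvariant L :=
  fun x y z => by
    simp only [normalizedForm, LinearMap.smul_apply]
    rw [LieModule.traceForm_lieInvariant ℂ L L x y z, smul_neg]

/-- The untwisted affine Kac-Moody algebra `L[t, t⁻¹] ⊕ ℂ c ⊕ ℂ d` of the simple Lie algebra `L`
with highest root `θ`; an element is a triple `(f, a, b)` that stands for `f + a c + b d`. -/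
def Affine (_θ : H.root) : Type _ := Loop L × ℂ × ℂ

variable {θ : H.root}

instance : AddCommGroup (Affine θ) := inferInstanceAs (AddCommGroup (Loop L × ℂ × ℂ))

instance : Module ℂ (Affine θ) := inferInstanceAs (Module ℂ (Loop L × ℂ × ℂ))

/-- `[f + a₁ c + b₁ d, g + a₂ c + b₂ d] = [f, g] + b₁ t g' - b₂ t f' + ψ(f, g) c`. -/
instance : Bracket (Affine θ) (Affine θ) where
  bracket x y := (⁅x.1, y.1⁆ + x.2.2 • loopDeriv L y.1 - y.2.2 • loopDeriv L x.1,
    loopCocycle (normalizedForm θ) x.1 y.1, 0)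

theorem affine_bracket (x y : Affine θ) :
    ⁅x, y⁆ = ((⁅x.1, y.1⁆ + x.2.2 • loopDeriv L y.1 - y.2.2 • loopDeriv L x.1,
      loopCocycle (normalizedForm θ) x.1 y.1, 0) : Loop L × ℂ × ℂ) := rfl

instance : LieRing (Affine θ) where
  add_lie := by
    rintro ⟨f, a, b⟩ ⟨g, a', b'⟩ ⟨k, a'', b''⟩
    refine Prod.ext ?_ (Prod.ext ?_ ?_)
    · change ⁅f + g, k⁆ + (b + b') • loopDeriv L k - b'' • loopDeriv L (f + g) =
        (⁅f, k⁆ + b • loopDeriv L k - b'' • loopDeriv L f) +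
        (⁅g, k⁆ + b' • loopDeriv L k - b'' • loopDeriv L g)
      simp only [add_lie, map_add]; module
    · change loopCocycle (normalizedForm θ) (f + g) k =
        loopCocycle (normalizedForm θ) f k + loopCocycle (normalizedForm θ) g k
      simp
    · exact (add_zero (0 : ℂ)).symm
  lie_add := by
    rintro ⟨f, a, b⟩ ⟨g, a', b'⟩ ⟨k, a'', b''⟩
    refine Prod.ext ?_ (Prod.ext ?_ ?_)
    · change ⁅f, g + k⁆ + b • loopDeriv L (g + k) - (b' + b'') • loopDeriv L f =
        (⁅f, g⁆ + b • loopDeriv L g - b' • loopDeriv L f) +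
        (⁅f, k⁆ + b • loopDeriv L k - b'' • loopDeriv L f)
      simp only [lie_add, map_add]; module
    · change loopCocycle (normalizedForm θ) f (g + k) =
        loopCocycle (normalizedForm θ) f g + loopCocycle (normalizedForm θ) f k
      simp
    · exact (add_zero (0 : ℂ)).symm
  lie_self := by
    rintro ⟨f, a, b⟩
    refine Prod.ext ?_ (Prod.ext ?_ rfl)
    · change ⁅f, f⁆ + b • loopDeriv L f - b • loopDeriv L f = 0
      simp
    · exact loopCocycle_self _ (normalizedForm_isSymm θ) f
  leibniz_lie := by
    rintro ⟨f, a, b⟩ ⟨g, a', b'⟩ ⟨k, a'', b''⟩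
    refine Prod.ext ?_ (Prod.ext ?_ ?_)
    · change ⁅f, ⁅g, k⁆ + b' • loopDeriv L k - b'' • loopDeriv L g⁆ +
          b • loopDeriv L (⁅g, k⁆ + b' • loopDeriv L k - b'' • loopDeriv L g) -
          (0 : ℂ) • loopDeriv L f =
        (⁅⁅f, g⁆ + b • loopDeriv L g - b' • loopDeriv L f, k⁆ + (0 : ℂ) • loopDeriv L k -
          b'' • loopDeriv L (⁅f, g⁆ + b • loopDeriv L g - b' • loopDeriv L f)) +
        (⁅g, ⁅f, k⁆ + b • loopDeriv L k - b'' • loopDeriv L f⁆ +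
          b' • loopDeriv L (⁅f, k⁆ + b • loopDeriv L k - b'' • loopDeriv L f) -
          (0 : ℂ) • loopDeriv L g)
      simp only [lie_add, lie_sub, lie_smul, add_lie, sub_lie, smul_lie, map_add, map_sub, map_smul,
        loopDeriv_lie]
      rw [leibniz_lie f g k, ← lie_skew g (loopDeriv L f)]
      module
    · change loopCocycle (normalizedForm θ) f
          (⁅g, k⁆ + b' • loopDeriv L k - b'' • loopDeriv L g) =
        loopCocycle (normalizedForm θ) (⁅f, g⁆ + b • loopDeriv L g - b' • loopDeriv L f) k +
        loopCocycle (normalizedForm θ) g (⁅f, k⁆ + b • loopDeriv L k - b'' • loopDeriv L f)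
      have hs := normalizedForm_isSymm θ
      have h1 := loopCocycle_jacobi _ hs (normalizedForm_lieInvariant θ) f g k
      have h2 := loopCocycle_deriv _ hs f k
      have h3 := loopCocycle_deriv _ hs g k
      have h4 := loopCocycle_deriv _ hs f g
      have h5 := loopCocycle_skew _ hs g (loopDeriv L f)
      simp only [map_add, map_sub, map_smul, LinearMap.add_apply, LinearMap.sub_apply,
        LinearMap.smul_apply, smul_eq_mul]
      linear_combination h1 + b' * h2 - b * h3 - b'' * h4 + b'' * h5
    · exact (add_zero (0 : ℂ)).symm

instance : LieAlgebra ℂ (Affine θ) where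
  lie_smul := by
    rintro z ⟨f, a, b⟩ ⟨g, a', b'⟩
    refine Prod.ext ?_ (Prod.ext ?_ ?_)
    · change ⁅f, z • g⁆ + b • loopDeriv L (z • g) - (z • b') • loopDeriv L f =
        z • (⁅f, g⁆ + b • loopDeriv L g - b' • loopDeriv L f)
      simp only [lie_smul, map_smul, smul_eq_mul]; module
    · change loopCocycle (normalizedForm θ) f (z • g) = z • loopCocycle (normalizedForm θ) f g
      simp
    · exact (smul_zero z).symm

variable (θ) in
/-- The element `x ⊗ t ^ r` of the affine Lie algebra. -/
def affElt (r : ℤ) (x : L) : Affine θ := (loopElt r x, 0, 0)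

variable (θ) in
/-- The canonical central element `c`. -/
def affC : Affine θ := (0, 1, 0)

variable (θ) in
/-- The degree derivation `d`. -/
def affD : Affine θ := (0, 0, 1)

theorem lie_affElt (r s : ℤ) (x y : L) :
    ⁅affElt θ r x, affElt θ s y⁆ = affElt θ (r + s) ⁅x, y⁆ +
      (if r + s = 0 then (r : ℂ) * normalizedForm θ x y else 0) • affC θ := by
  refine Prod.ext ?_ (Prod.ext ?_ ?_)
  · change ⁅loopElt r x, loopElt s y⁆ + (0 : ℂ) • loopDeriv L (loopElt s y)
      - (0 : ℂ) • loopDeriv L (loopElt r x) = loopElt (r + s) ⁅x, y⁆ + _ • (0 : Loop L)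
    rw [lie_loopElt, zero_smul, zero_smul, smul_zero, sub_zero]
  · change loopCocycle (normalizedForm θ) (loopElt r x) (loopElt s y) = (0 : ℂ) + _ • (1 : ℂ)
    rw [loopCocycle_loopElt _ (normalizedForm_isSymm θ), zero_add, smul_eq_mul, mul_one]
  · change (0 : ℂ) = 0 + _ • (0 : ℂ)
    rw [smul_zero, zero_add]

theorem lie_affD_affElt (r : ℤ) (x : L) : ⁅affD θ, affElt θ r x⁆ = (r : ℂ) • affElt θ r x := by
  refine Prod.ext ?_ (Prod.ext ?_ ?_)
  · change ⁅(0 : Loop L), loopElt r x⁆ + (1 : ℂ) • loopDeriv L (loopElt r x)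
      - (0 : ℂ) • loopDeriv L 0 = (r : ℂ) • loopElt r x
    rw [zero_lie, loopDeriv_loopElt, one_smul, zero_smul, sub_zero, zero_add]
  · change loopCocycle (normalizedForm θ) 0 (loopElt r x) = (r : ℂ) • (0 : ℂ)
    simp
  · change (0 : ℂ) = (r : ℂ) • (0 : ℂ)
    simp

end Affine

/-! ### Roots and the parabolic subalgebras -/

section Parabolic

variable {L : Type*} [LieRing L] [LieAlgebra ℂ L] [FiniteDimensional ℂ L] [IsSimple ℂ L]
  {H : LieSubalgebra ℂ L} [H.IsCartanSubalgebra] (b : (IsKilling.rootSystem H).Base)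

/-- `θ` is the highest root: `θ - β` is a sum of simple roots for every root `β`. -/
def IsHighestRoot (θ : H.root) : Prop :=
  ∀ β : H.root, (IsKilling.rootSystem H).root θ - (IsKilling.rootSystem H).root β ∈
    AddSubmonoid.closure ((IsKilling.rootSystem H).root '' b.support)

/-- The index set `I` of the affine simple roots: `none` is the zeroth node and `some i` are the
nodes of the finite diagram. -/
abbrev Node : Type _ := Option b.support

/-- The root lattice of the simple Lie algebra. -/
abbrev FinRootLattice (H : LieSubalgebra ℂ L) [H.IsCartanSubalgebra] : Type _ :=
  (IsKilling.rootSystem H).rootSpan ℤ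

/-- A root of the simple Lie algebra as an element of the root lattice. -/
abbrev finRoot (α : H.root) : FinRootLattice H := (IsKilling.rootSystem H).rootSpanMem ℤ α

/-- The affine root lattice `Q`; the pair `(β, r)` stands for `β + r δ`. -/
abbrev AffRootLattice (H : LieSubalgebra ℂ L) [H.IsCartanSubalgebra] : Type _ :=
  FinRootLattice H × ℤ

/-- The affine simple roots, with `α₀ = -θ + δ`. -/
def simpleRoot (θ : H.root) : Node b → AffRootLattice H
  | none => (-finRoot θ, 1)
  | some i => (finRoot i, 0)

/-- The coefficients `a_i(γ)` of `γ = ∑ i, a_i(γ) α_i` in the affine simple roots. -/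
def nodeCoeff (θ : H.root) : Node b → AffRootLattice H → ℤ
  | none, γ => γ.2
  | some i, γ => b.toWeightBasisInt.repr (γ.1 + γ.2 • finRoot θ) i

theorem sum_nodeCoeff_smul_simpleRoot (θ : H.root) (γ : AffRootLattice H) :
    ∑ i, nodeCoeff b θ i γ • simpleRoot b θ i = γ := by
  have h : ∀ i : b.support, finRoot (i : H.root) = b.toWeightBasisInt i := fun i => by
    ext1; simp
  rw [Fintype.sum_option]
  refine Prod.ext ?_ ?_
  · simp only [nodeCoeff, simpleRoot, Prod.fst_add, Prod.smul_fst, Prod.fst_sum, h]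
    rw [b.toWeightBasisInt.sum_repr]
    module
  · simp [nodeCoeff, simpleRoot, Prod.snd_sum]

open Classical in
/-- The grade `gr_J(γ) = ∑_{i ∉ J} a_i(γ)`. -/
def gr (θ : H.root) (J : Set (Node b)) (γ : AffRootLattice H) : ℤ :=
  ∑ i, if i ∈ J then 0 else nodeCoeff b θ i γ

/-- `m = gr_J(δ)`. -/
def period (θ : H.root) (J : Set (Node b)) : ℕ := (gr b θ J (0, 1)).toNat

/-- The standard Borel subalgebra
`(L ⊗ t ℂ[t]) ⊕ (𝔟 ⊗ 1) ⊕ ℂ c ⊕ ℂ d`, as a subspace of the affine Lie algebra. -/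
def borel (θ : H.root) : Submodule ℂ (Affine θ) :=
  Submodule.span ℂ
    ({z | ∃ (r : ℤ) (x : L), 0 < r ∧ z = affElt θ r x} ∪
     {z | ∃ x ∈ H, z = affElt θ 0 x} ∪
     {z | ∃ α : H.root, b.IsPos α ∧ ∃ x ∈ rootSpace H α.1, z = affElt θ 0 x} ∪
     {affC θ, affD θ})

/-- The root space of the negative `-α_i` of an affine simple root. -/
def negSimpleRootSpace (θ : H.root) : Node b → Set (Affine θ)
  | none => {z | ∃ x ∈ rootSpace H θ.1, z = affElt θ (-1) x}
  | some i => {z | ∃ x ∈ rootSpace H (-i.1.1), z = affElt θ 0 x}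

/-- The parabolic subalgebra `𝔭_J`, generated by the standard Borel subalgebra and the root spaces
of the `-α_i` with `i ∈ J`. -/
def parabolic (θ : H.root) (J : Set (Node b)) : LieSubalgebra ℂ (Affine θ) :=
  LieSubalgebra.lieSpan ℂ (Affine θ) (borel b θ ∪ ⋃ i ∈ J, negSimpleRootSpace b θ i)

/-- The intersection of the parabolic subalgebra `𝔭_J` with the commutator subalgebra
`[𝔤, 𝔤] = L[t, t⁻¹] ⊕ ℂ c` of the affine Lie algebra `𝔤`. -/
def derivedParabolic (θ : H.root) (J : Set (Node b)) : LieSubalgebra ℂ (Affine θ) :=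
  parabolic b θ J ⊓ (derivedSeries ℂ (Affine θ) 1).toLieSubalgebra

/-- The Lie algebra `𝔭̃_J`: the algebra `𝔭_J ∩ [𝔤, 𝔤]` modulo its center. -/
abbrev ReducedParabolic (θ : H.root) (J : Set (Node b)) : Type _ :=
  derivedParabolic b θ J ⧸ LieAlgebra.center ℂ (derivedParabolic b θ J)

/-- The class in `𝔭̃_J` of an element of `𝔭_J ∩ [𝔤, 𝔤]`. -/
def toReduced (θ : H.root) (J : Set (Node b)) :
    derivedParabolic b θ J →ₗ[ℂ] ReducedParabolic b θ J :=
  (LieSubmodule.Quotient.mk' (LieAlgebra.center ℂ (derivedParabolic b θ J)) :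
    derivedParabolic b θ J →ₗ[ℂ] ReducedParabolic b θ J)

/-- The graded component of `𝔭̃_J` of grade `k`: it is spanned by the classes of the weight vectors
`x ⊗ t ^ r` of weight `β + r δ` with `gr_J(β + r δ) = k`. The case `β = 0`, in which `x` lies in
the Cartan subalgebra, is included. -/
def reducedPiece (θ : H.root) (J : Set (Node b)) (k : ℕ) :
    Submodule ℂ (ReducedParabolic b θ J) :=
  Submodule.span ℂ {y | ∃ (β : FinRootLattice H) (r : ℤ), gr b θ J (β, r) = k ∧
    ∃ x ∈ rootSpace H (β : Module.Dual ℂ H), ∃ h : affElt θ r x ∈ derivedParabolic b θ J,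
      y = toReduced b θ J ⟨affElt θ r x, h⟩}

end Parabolic

/-! ### Gradings and twisted current algebras -/

section Current

variable {L : Type*} [LieRing L] [LieAlgebra ℂ L]

/-- A family of subspaces is a `ℕ`-grading of a Lie algebra. -/
def IsLieGrading (V : ℕ → Submodule ℂ L) : Prop :=
  DirectSum.IsInternal V ∧ ∀ i j, ∀ x ∈ V i, ∀ y ∈ V j, ⁅x, y⁆ ∈ V (i + j)

variable (L) in
/-- The current algebra `L ⊗ ℂ[t]` (the polynomials are the left factor). -/
def Current : Type _ := ℂ[X] ⊗[ℂ] L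

instance : LieRing (Current L) := ExtendScalars.instLieRing ℂ ℂ[X] L

instance : LieAlgebra ℂ (Current L) := ExtendScalars.instBaseLieAlgebra ℂ ℂ[X] L

/-- The element `x ⊗ t ^ k` of the current algebra. -/
def currentElt (k : ℕ) : L →ₗ[ℂ] Current L := TensorProduct.mk ℂ ℂ[X] L (Polynomial.X ^ k)

/-- The extension `x ⊗ t ^ r ↦ ξ ^ (-r) σ(x) ⊗ t ^ r` of `σ` to the current algebra. -/
def currentHom (ξ : ℂ) (σ : L ≃ₗ⁅ℂ⁆ L) : Current L →ₗ⁅ℂ⁆ Current L :=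
  LieAlgebra.ExtendScalars.map
    (Polynomial.aeval (Polynomial.C ξ⁻¹ * Polynomial.X) : ℂ[X] →ₐ[ℂ] ℂ[X]) (σ : L →ₗ⁅ℂ⁆ L)

theorem currentHom_currentElt (ξ : ℂ) (σ : L ≃ₗ⁅ℂ⁆ L) (k : ℕ) (x : L) :
    currentHom ξ σ (currentElt k x) = (ξ⁻¹ ^ k) • currentElt k (σ x) := by
  change TensorProduct.map _ _ ((Polynomial.X ^ k : ℂ[X]) ⊗ₜ[ℂ] x) =
    (ξ⁻¹ ^ k) • ((Polynomial.X ^ k : ℂ[X]) ⊗ₜ[ℂ] σ x : ℂ[X] ⊗[ℂ] L)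
  rw [TensorProduct.map_tmul, TensorProduct.smul_tmul', Polynomial.smul_eq_C_mul,
    Polynomial.C_pow]
  simp only [AlgHom.toLinearMap_apply, map_pow, Polynomial.aeval_X, mul_pow]
  rfl

/-- The twisted current algebra `L[t]^σ`: the fixed points of `σ` on the current algebra. -/
def twistedCurrent (ξ : ℂ) (σ : L ≃ₗ⁅ℂ⁆ L) : LieSubalgebra ℂ (Current L) where
  __ := LinearMap.eqLocus (currentHom ξ σ : Current L →ₗ[ℂ] Current L) LinearMap.id
  lie_mem' := by
    intro f g hf hg
    change currentHom ξ σ ⁅f, g⁆ = ⁅f, g⁆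
    have hf' : currentHom ξ σ f = f := hf
    have hg' : currentHom ξ σ g = g := hg
    rw [LieHom.map_lie, hf', hg']

/-- The graded component of degree `k`: the elements of `L[t]^σ` of the form `x ⊗ t ^ k`. -/
def twistedPiece (ξ : ℂ) (σ : L ≃ₗ⁅ℂ⁆ L) (k : ℕ) : Submodule ℂ (twistedCurrent ξ σ) :=
  (LinearMap.range (currentElt (L := L) k)).comap (twistedCurrent ξ σ).toSubmodule.subtype

end Current

/-! ### The automorphism of Kac type -/

section Kac

variable {L : Type*} [LieRing L] [LieAlgebra ℂ L] [FiniteDimensional ℂ L] [IsSimple ℂ L]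
  {H : LieSubalgebra ℂ L} [H.IsCartanSubalgebra] (b : (IsKilling.rootSystem H).Base)

open Classical in
/-- `s_i = 0` for `i ∈ J` and `s_i = 1` otherwise. -/
def kacLabel (J : Set (Node b)) (i : Node b) : ℕ := if i ∈ J then 0 else 1

/-- The automorphism `σ` satisfies `x_i⁺ ↦ ξ ^ s_i x_i⁺` for the simple root vectors and
`x_θ⁻ ↦ ξ ^ s_0 x_θ⁻`. -/
structure IsKacAutomorphism (θ : H.root) (J : Set (Node b)) (ξ : ℂ) (σ : L ≃ₗ⁅ℂ⁆ L) : Prop where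
  simple : ∀ i : b.support, ∀ x ∈ rootSpace H i.1.1, σ x = ξ ^ kacLabel b J (some i) • x
  lowest : ∀ x ∈ rootSpace H (-θ.1), σ x = ξ ^ kacLabel b J none • x

/-- The linear map `φ : 𝔭̃_J → L[t]^σ` sends the class of every nonzero weight vector `x ⊗ t ^ r`
of weight `β + r δ` that lies in `𝔭_J ∩ [𝔤, 𝔤]` to `x ⊗ t ^ gr_J(β + r δ)`, and the exponent is a
nonnegative integer. -/
def RegradesWeight (θ : H.root) (J : Set (Node b)) (ξ : ℂ) (σ : L ≃ₗ⁅ℂ⁆ L)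
    (φ : ReducedParabolic b θ J →ₗ[ℂ] twistedCurrent ξ σ) (β : FinRootLattice H) : Prop :=
  ∀ (r : ℤ), ∀ x ∈ rootSpace H (β : Module.Dual ℂ H), x ≠ 0 →
    ∀ h : affElt θ r x ∈ derivedParabolic b θ J,
      0 ≤ gr b θ J (β, r) ∧
      (φ (toReduced b θ J ⟨affElt θ r x, h⟩) : Current L) =
        currentElt (gr b θ J (β, r)).toNat x

end Kac

end AffineParabolic

end

/-!
Write `V_β` for the weight space of `β` in the root lattice, so that the simple Lie algebra `L` is
the direct sum of the `V_β`, and `g(β) = gr_J(β)`. The grade is additive and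
`gr_J(β + r δ) = g(β) + r m`, where `m = gr_J(δ) > 0` because every simple root occurs in `θ`.

*The automorphism.* Acting by `ξ ^ g(β)` on `V_β` defines an automorphism (`kacEquiv`) with the
prescribed values, since `ξ ^ m = 1`. It is the only one because the root spaces of the finite parts
of the affine simple roots generate `L` (`IsHighestRoot.eq_top_of_nodeRoot_le`): each `α + δ` is a
positive real affine root, and induction on the height applies. The induction step
(`IsHighestRoot.exists_sub_simpleRoot`) is that a positive real affine root, expanded in the affine
simple roots and paired with its coroot, gives `2 > 0`, so some simple root in its support pairs
positively with it and may be subtracted; it is lifted to root vectors by `[V_α, V_β] = V_{α + β}`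
(`exists_lie_eq_of_add`).

*The parabolic subalgebra.* The same induction shows that `𝔭_J` is the span of `c`, `d` and the
`x ⊗ t ^ r` with `x ∈ V_β` and `gr_J(β + r δ) ≥ 0`: a root of nonnegative grade is positive, or is
the negative of a positive root with support in `J`. As the commutator subalgebra of the affine Lie
algebra consists of the elements without `d`, this determines `𝔭_J ∩ [𝔤, 𝔤]`
(`IsHighestRoot.derivedParabolic_eq`).

*The isomorphism.* The map `x ⊗ t ^ r ↦ x ⊗ t ^ gr_J(β + r δ)` for `x ∈ V_β` is a homomorphism
`regradeHom` by additivity of the grade. Its kernel is `ℂ c`, because `m > 0` lets `r` be recovered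
from the grade, and `ℂ c` is the center. The fixed points `x ⊗ t ^ k` of `σ` are those where `x` is
a sum of vectors in spaces `V_β` with `g(β) ≡ k` modulo `m`; hence the range is the twisted current
algebra, and grades correspond to degrees. The gradings are read off on the twisted side.

*Uniqueness.* Two isomorphisms that agree on the root vectors agree on `h ⊗ t ^ r`, as the
difference of the two values commutes with some `x ⊗ t ^ j` for every root vector `x`.

*The case `|J| = n`.* Only the vectors `h ⊗ 1` are not obviously commutators modulo `c`. They are,
because the coroots of the `α_i` with `i ∈ J` span the Cartan subalgebra.
-/

noncomputable section

namespace AffineParabolic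

/-! ### Linear maps on an internal direct sum -/

section GradedMap

variable {ι A M : Type*} [DecidableEq ι] [AddCommGroup A] [Module ℂ A] [AddCommGroup M]
  [Module ℂ M] {V : ι → Submodule ℂ A} (hV : DirectSum.IsInternal V)

/-- The decomposition of `A` as the direct sum of the `V i`. -/
def gradedEquiv : A ≃ₗ[ℂ] DirectSum ι fun i => V i :=
  (LinearEquiv.ofBijective (DirectSum.coeLinearMap V)
    (show Function.Bijective (DirectSum.coeLinearMap V) from hV)).symm

theorem gradedEquiv_of_mem {i : ι} {x : A} (hx : x ∈ V i) :
    gradedEquiv hV x = DirectSum.lof ℂ ι (fun i => V i) i ⟨x, hx⟩ := by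
  rw [gradedEquiv, LinearEquiv.symm_apply_eq, LinearEquiv.ofBijective_apply,
    DirectSum.coeLinearMap_lof]

/-- The linear map on `A = ⨁ i, V i` that agrees with `F i` on the summand `V i`. -/
def gradedMap (F : ι → A →ₗ[ℂ] M) : A →ₗ[ℂ] M :=
  DirectSum.toModule ℂ ι M (fun i => F i ∘ₗ (V i).subtype) ∘ₗ (gradedEquiv hV).toLinearMap

theorem gradedMap_apply (F : ι → A →ₗ[ℂ] M) {i : ι} {x : A} (hx : x ∈ V i) :
    gradedMap hV F x = F i x := by
  simp [gradedMap, gradedEquiv_of_mem hV hx]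

/-- The component in the summand `V i`. -/
def gradedComp (i : ι) : A →ₗ[ℂ] A :=
  (V i).subtype ∘ₗ DirectSum.component ℂ ι (fun i => V i) i ∘ₗ (gradedEquiv hV).toLinearMap

theorem gradedComp_mem (i : ι) (x : A) : gradedComp hV i x ∈ V i := by
  simp [gradedComp]

theorem exists_sum_gradedComp (x : A) : ∃ s : Finset ι, x = ∑ i ∈ s, gradedComp hV i x := by
  classical
  refine ⟨DFinsupp.support (gradedEquiv hV x), ?_⟩
  conv_lhs => rw [← (gradedEquiv hV).symm_apply_apply x]
  exact DirectSum.coeLinearMap_eq_dfinsuppSum _ _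

include hV in
@[elab_as_elim]
theorem graded_induction {p : A → Prop} (x : A) (mem : ∀ i, ∀ x ∈ V i, p x)
    (zero : p 0) (add : ∀ x y, p x → p y → p (x + y)) : p x := by
  have h : x ∈ ⨆ i, V i := by rw [hV.submodule_iSup_eq_top]; trivial
  exact Submodule.iSup_induction V (motive := p) h mem zero add

theorem gradedComp_of_mem {i : ι} {x : A} (hx : x ∈ V i) (j : ι) :
    gradedComp hV j x = if j = i then x else 0 := by
  simp only [gradedComp, LinearMap.comp_apply, LinearEquiv.coe_coe, gradedEquiv_of_mem hV hx]
  by_cases hj : j = i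
  · subst hj
    simp [DirectSum.component.lof_self]
  · rw [if_neg hj, DirectSum.component.of, dif_neg (Ne.symm hj)]
    simp

/-- If each `x ∈ V i` has `p j x = 0` for `j ≠ i` and is determined by `p i x`, then the `V i` are
independent. -/
theorem iSupIndep_of_separating {ι A M : Type*} [AddCommGroup A] [Module ℂ A] [AddCommGroup M]
    [Module ℂ M] {V : ι → Submodule ℂ A} (p : ι → A →ₗ[ℂ] M)
    (hp : ∀ i, ∀ x ∈ V i, p i x = 0 → x = 0) (hp' : ∀ i j, i ≠ j → ∀ x ∈ V i, p j x = 0) :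
    iSupIndep V := by
  rw [iSupIndep_def]
  intro i
  rw [Submodule.disjoint_def]
  intro x hx hx'
  refine hp i x hx ?_
  have : (⨆ j, ⨆ (_ : j ≠ i), V j) ≤ LinearMap.ker (p i) :=
    iSup₂_le fun j hj y hy => hp' j i hj y hy
  exact this hx'

end GradedMap

/-! ### Root spaces of a simple Lie algebra -/

section Roots

variable {L : Type*} [LieRing L] [LieAlgebra ℂ L] [FiniteDimensional ℂ L] [IsSimple ℂ L]
  {H : LieSubalgebra ℂ L} [H.IsCartanSubalgebra]

instance finRootLatticeDecidableEq : DecidableEq (FinRootLattice H) := Classical.decEq _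

/-- The weight space of weight `β` under the adjoint action, for `β` in the root lattice. -/
def wt (β : FinRootLattice H) : Submodule ℂ L :=
  (rootSpace H (β : Module.Dual ℂ H)).toSubmodule

theorem mem_wt_zero {x : L} : x ∈ wt (0 : FinRootLattice H) ↔ x ∈ H := by
  have : x ∈ rootSpace H (0 : H → ℂ) ↔ x ∈ H := by
    rw [LieAlgebra.rootSpace_zero_eq]; rfl
  exact this

theorem lie_mem_wt {β γ : FinRootLattice H} {x y : L} (hx : x ∈ wt β) (hy : y ∈ wt γ) :
    ⁅x, y⁆ ∈ wt (β + γ) :=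
  LieAlgebra.lie_mem_genWeightSpace_of_mem_genWeightSpace hx hy

theorem wt_eq_bot_or (β : FinRootLattice H) :
    wt β = ⊥ ∨ β = 0 ∨ ∃ α : H.root, β = finRoot α := by
  by_cases h : wt β = ⊥
  · exact .inl h
  by_cases h0 : β = 0
  · exact .inr (.inl h0)
  right; right
  have h' : rootSpace H (β : Module.Dual ℂ H) ≠ ⊥ := by
    intro e; exact h (by rw [wt, e]; rfl)
  let α : Weight ℂ H L := ⟨(β : Module.Dual ℂ H), h'⟩
  have hα : α ∈ H.root := by
    simp only [LieSubalgebra.root, Finset.mem_filter, Finset.mem_univ, true_and]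
    intro e
    apply h0
    ext h
    exact congrFun e h
  exact ⟨⟨α, hα⟩, by ext; rfl⟩

variable (H) in
theorem wt_isInternal : DirectSum.IsInternal (wt : FinRootLattice H → Submodule ℂ L) := by
  apply DirectSum.isInternal_submodule_of_iSupIndep_of_iSup_eq_top
  · have h := LieSubmodule.iSupIndep_toSubmodule.mpr (iSupIndep_genWeightSpace ℂ H L)
    refine h.comp (f := fun β : FinRootLattice H => ((β : Module.Dual ℂ H) : H → ℂ)) ?_
    intro β γ e
    ext x
    exact congrFun e x
  · rw [eq_top_iff]
    have h := LieSubmodule.iSup_toSubmodule_eq_top.mpr (iSup_genWeightSpace_eq_top' ℂ H L)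
    rw [← h]
    refine iSup_le fun α => ?_
    by_cases hα : α ∈ H.root
    · exact le_iSup (wt : FinRootLattice H → Submodule ℂ L) (finRoot ⟨α, hα⟩)
    · have : (α : H → ℂ) = 0 := by
        by_contra h0
        exact hα (Finset.mem_filter.mpr ⟨Finset.mem_univ _, h0⟩)
      rw [this]
      exact le_iSup (wt : FinRootLattice H → Submodule ℂ L) 0

theorem lie_of_mem_wt {β : FinRootLattice H} {x : L} (hx : x ∈ wt β) (h : H) :
    ⁅(h : L), x⁆ = (β : Module.Dual ℂ H) h • x :=
  IsKilling.lie_eq_smul_of_mem_rootSpace hx h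

/-- If `α`, `β` and `α + β` are roots, every vector of weight `α + β` is a bracket of vectors of
weights `α` and `β`: the vectors of the `α`-string through `β` come from a primitive vector of
the `𝔰𝔩₂`-triple of `α`. -/
theorem exists_lie_eq_of_add {α β γ : H.root} (h : finRoot γ = finRoot α + finRoot β) {x : L}
    (hx : x ∈ wt (finRoot γ)) :
    ∃ y ∈ wt (finRoot α), ∃ z ∈ wt (finRoot β), ⁅y, z⁆ = x := by
  have hα : α.1.IsNonZero := H.isNonZero_coe_root α
  have hγ : γ.1.IsNonZero := H.isNonZero_coe_root γ
  have hsum : ((γ : Weight ℂ H L) : H → ℂ) = (α : Weight ℂ H L) + (β : Weight ℂ H L) := by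
    funext t
    exact LinearMap.congr_fun (congrArg Subtype.val h) t
  obtain ⟨p, hp⟩ : ∃ p, chainTopCoeff α.1 β.1 = p + 1 := by
    refine Nat.exists_eq_succ_of_ne_zero fun h0 => ?_
    have := genWeightSpace_chainTopCoeff_add_one_nsmul_add α.1 β.1 hα
    rw [h0, zero_add, one_smul, ← hsum] at this
    exact γ.1.genWeightSpace_ne_bot' this
  have hle := IsKilling.chainTopCoeff_le_chainLength α.1 β.1
  obtain ⟨v, hv, v_ne0⟩ := (chainTop α.1 β.1).exists_ne_zero
  obtain ⟨t, e, f, isSl2, he, hf⟩ := IsKilling.exists_isSl2Triple_of_weight_isNonZero hα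
  obtain rfl := isSl2.h_eq_coroot hα he hf
  have prim : isSl2.HasPrimitiveVectorWith v (IsKilling.chainLength α.1 β.1 : ℂ) :=
    have := lie_mem_genWeightSpace_of_mem_genWeightSpace he hv
    ⟨v_ne0, (IsKilling.chainLength_smul _ _ hv).symm,
      by rwa [genWeightSpace_add_chainTop _ _ hα] at this⟩
  have hz := toEnd_pow_apply_mem hf hv (p + 1)
  have hw := toEnd_pow_apply_mem hf hv p
  have hβ' : ((p + 1) • (-(α : Weight ℂ H L)) + chainTop α.1 β.1 : H → ℂ) = β.1 := by
    rw [coe_chainTop', hp]; funext t; simp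
  have hγ' : (p • (-(α : Weight ℂ H L)) + chainTop α.1 β.1 : H → ℂ) = γ.1 := by
    rw [coe_chainTop', hp, hsum]; funext t; simp; ring
  rw [hβ'] at hz
  rw [hγ'] at hw
  have hw0 := prim.pow_toEnd_f_ne_zero_of_eq_nat rfl (i := p) (by omega)
  have hez := prim.lie_e_pow_succ_toEnd_f p
  set w := (toEnd ℂ L L f ^ p) v
  obtain ⟨k, hk⟩ : ∃ k : ℂ, k • w = x := by
    obtain ⟨k, hk⟩ := (finrank_eq_one_iff_of_nonzero' (⟨w, hw⟩ : rootSpace H γ.1)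
      (by simpa using hw0)).mp (IsKilling.finrank_rootSpace_eq_one _ hγ) ⟨x, hx⟩
    exact ⟨k, congrArg Subtype.val hk⟩
  set N := IsKilling.chainLength α.1 β.1
  have hc : (((p : ℂ) + 1) * ((N : ℂ) - p)) ≠ 0 := by
    refine mul_ne_zero (Nat.cast_add_one_ne_zero p) (sub_ne_zero.mpr ?_)
    exact_mod_cast (show N ≠ p by omega)
  refine ⟨(k * (((p : ℂ) + 1) * ((N : ℂ) - p))⁻¹) • e, Submodule.smul_mem _ _ he, _, hz, ?_⟩
  rw [smul_lie, hez, smul_smul, mul_assoc, inv_mul_cancel₀ hc, mul_one, hk]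

end Roots

/-! ### Affine roots -/

section AffineRoots

variable {L : Type*} [LieRing L] [LieAlgebra ℂ L] [FiniteDimensional ℂ L] [IsSimple ℂ L]
  {H : LieSubalgebra ℂ L} [H.IsCartanSubalgebra] (b : (IsKilling.rootSystem H).Base)

/-- The negative of a root. -/
def negRoot (α : H.root) : H.root :=
  ⟨-α.1, Finset.mem_filter.mpr ⟨Finset.mem_univ _, (H.isNonZero_coe_root α).neg⟩⟩

@[simp] theorem finRoot_negRoot (α : H.root) : finRoot (negRoot α) = -finRoot α := rfl

theorem finRoot_injective : Function.Injective (finRoot : H.root → FinRootLattice H) :=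
  fun _ _ h => (IsKilling.rootSystem H).root.injective (congrArg Subtype.val h)

/-- The finite part of the affine simple root `α_i`. -/
def nodeRoot (θ : H.root) : Node b → H.root
  | none => negRoot θ
  | some i => i

/-- The coefficient of `δ` in the affine simple root `α_i`. -/
def nodeShift : Node b → ℤ
  | none => 1
  | some _ => 0

theorem simpleRoot_eq (θ : H.root) (i : Node b) :
    simpleRoot b θ i = (finRoot (nodeRoot b θ i), nodeShift b i) := by
  cases i <;> rfl

/-- The coefficient of the simple root `i` as a homomorphism on the finite root lattice. -/
def finCoeff (i : b.support) : FinRootLattice H →+ ℤ :=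
  (Finsupp.applyAddHom i).comp b.toWeightBasisInt.repr.toLinearMap.toAddMonoidHom

theorem nodeCoeff_some (θ : H.root) (i : b.support) (γ : AffRootLattice H) :
    nodeCoeff b θ (some i) γ = finCoeff b i (γ.1 + γ.2 • finRoot θ) := rfl

theorem toWeightBasisInt_apply (i : b.support) : b.toWeightBasisInt i = finRoot (i : H.root) := by
  ext1; simp

theorem finCoeff_simple [DecidableEq b.support] (i j : b.support) :
    finCoeff b i (finRoot j) = if i = j then 1 else 0 := by
  rw [← toWeightBasisInt_apply]
  change b.toWeightBasisInt.repr (b.toWeightBasisInt j) i = _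
  rw [Module.Basis.repr_self, Finsupp.single_apply]
  simp only [eq_comm]

theorem nodeCoeff_add (θ : H.root) (i : Node b) (γ γ' : AffRootLattice H) :
    nodeCoeff b θ i (γ + γ') = nodeCoeff b θ i γ + nodeCoeff b θ i γ' := by
  cases i with
  | none => rfl
  | some i =>
    have h : (γ + γ').1 + (γ + γ').2 • finRoot θ =
        (γ.1 + γ.2 • finRoot θ) + (γ'.1 + γ'.2 • finRoot θ) := by
      rw [Prod.fst_add, Prod.snd_add]; module
    rw [nodeCoeff_some, h, map_add, nodeCoeff_some, nodeCoeff_some]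

/-- The coefficient `a_i` as a homomorphism. -/
def nodeCoeffHom (θ : H.root) (i : Node b) : AffRootLattice H →+ ℤ :=
  AddMonoidHom.mk' (nodeCoeff b θ i) (nodeCoeff_add b θ i)

theorem nodeCoeff_simpleRoot [DecidableEq (Node b)] (θ : H.root) (i j : Node b) :
    nodeCoeff b θ i (simpleRoot b θ j) = if i = j then 1 else 0 := by
  classical
  cases i with
  | none => cases j <;> simp [nodeCoeff, simpleRoot]
  | some i =>
    cases j with
    | none => simp [nodeCoeff_some, simpleRoot]
    | some j => simp [nodeCoeff_some, simpleRoot, finCoeff_simple]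

open Classical in
theorem gr_add (θ : H.root) (J : Set (Node b)) (γ γ' : AffRootLattice H) :
    gr b θ J (γ + γ') = gr b θ J γ + gr b θ J γ' := by
  simp only [gr, nodeCoeff_add, ← Finset.sum_add_distrib]
  refine Finset.sum_congr rfl fun i _ => ?_
  split_ifs <;> simp

/-- The grade `gr_J` as a homomorphism. -/
def grHom (θ : H.root) (J : Set (Node b)) : AffRootLattice H →+ ℤ :=
  AddMonoidHom.mk' (gr b θ J) (gr_add b θ J)

theorem gr_neg (θ : H.root) (J : Set (Node b)) (γ : AffRootLattice H) :
    gr b θ J (-γ) = -gr b θ J γ := map_neg (grHom b θ J) γ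

theorem gr_eq (θ : H.root) (J : Set (Node b)) (β : FinRootLattice H) (r : ℤ) :
    gr b θ J (β, r) = gr b θ J (β, 0) + r * gr b θ J (0, 1) := by
  have h : ((β, r) : AffRootLattice H) = (β, 0) + r • (0, 1) := by
    ext1 <;> simp
  have h2 : gr b θ J (r • ((0, 1) : AffRootLattice H)) = r * gr b θ J (0, 1) := by
    have := map_zsmul (grHom b θ J) r ((0, 1) : AffRootLattice H)
    rwa [smul_eq_mul] at this
  rw [h, gr_add, h2]

theorem gr_simpleRoot (θ : H.root) (J : Set (Node b)) (i : Node b) :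
    gr b θ J (simpleRoot b θ i) = kacLabel b J i := by
  classical
  simp only [gr, nodeCoeff_simpleRoot, kacLabel]
  rw [Finset.sum_eq_single i]
  · simp
  · intro j _ hj; simp [hj]
  · simp

theorem finCoeff_nonneg_of_mem_closure {v : Module.Dual ℂ H}
    (hv : v ∈ AddSubmonoid.closure ((IsKilling.rootSystem H).root '' b.support))
    {w : FinRootLattice H} (hw : (w : Module.Dual ℂ H) = v) (i : b.support) :
    0 ≤ finCoeff b i w := by
  classical
  obtain ⟨w', hw', h⟩ : ∃ w' : FinRootLattice H, (w' : Module.Dual ℂ H) = v ∧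
      ∀ i, 0 ≤ finCoeff b i w' := by
    clear hw
    induction hv using AddSubmonoid.closure_induction with
    | mem x hx =>
      obtain ⟨j, hj, rfl⟩ := hx
      refine ⟨finRoot j, rfl, fun i => ?_⟩
      rw [finCoeff_simple b i ⟨j, hj⟩]
      split_ifs <;> simp
    | zero => exact ⟨0, rfl, fun i => (map_zero (finCoeff b i)).ge⟩
    | add x y _ _ hx hy =>
      obtain ⟨x', rfl, hx⟩ := hx
      obtain ⟨y', rfl, hy⟩ := hy
      exact ⟨x' + y', rfl, fun i => by rw [map_add]; exact add_nonneg (hx i) (hy i)⟩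
  have : w = w' := Subtype.ext (hw.trans hw'.symm)
  exact this ▸ h i

theorem finCoeff_nonneg_or_nonpos (α : H.root) :
    (∀ i, 0 ≤ finCoeff b i (finRoot α)) ∨
      ∀ i, finCoeff b i (finRoot α) ≤ 0 := by
  rcases b.root_mem_or_neg_mem α with h | h
  · exact .inl fun i => finCoeff_nonneg_of_mem_closure b h rfl i
  · refine .inr fun i => ?_
    have := finCoeff_nonneg_of_mem_closure b h (w := -finRoot α) rfl i
    simpa using this

theorem height_eq_sum_finCoeff (α : H.root) :
    b.height α = ∑ i, finCoeff b i (finRoot α) := by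
  classical
  have h : ((∑ i, finCoeff b i (finRoot α) • b.toWeightBasisInt i : FinRootLattice H) :
      Module.Dual ℂ H) = (IsKilling.rootSystem H).root α :=
    congrArg Subtype.val (b.toWeightBasisInt.sum_repr (finRoot α))
  let f : H.root → ℤ := fun j =>
    if hj : j ∈ b.support then finCoeff b ⟨j, hj⟩ (finRoot α) else 0
  have hf : (IsKilling.rootSystem H).root α =
      ∑ j ∈ b.support, f j • (IsKilling.rootSystem H).root j := by
    rw [← Finset.sum_coe_sort]
    refine Eq.trans h.symm ?_
    rw [AddSubmonoidClass.coe_finsetSum]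
    refine Finset.sum_congr rfl fun i _ => ?_
    simp [f]
  rw [RootPairing.Base.height_eq_sum hf, ← Finset.sum_coe_sort]
  simp [f]

variable {b} {θ : H.root} (hθ : IsHighestRoot b θ)

include hθ

theorem IsHighestRoot.finCoeff_le (α : H.root) (i : b.support) :
    finCoeff b i (finRoot α) ≤ finCoeff b i (finRoot θ) := by
  have := finCoeff_nonneg_of_mem_closure b (hθ α) (w := finRoot θ - finRoot α) rfl i
  simpa using this

/-- The coefficients of `δ` are positive. -/
theorem IsHighestRoot.nodeCoeff_delta_pos (i : Node b) : 0 < nodeCoeff b θ i (0, 1) := by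
  cases i with
  | none => simp [nodeCoeff]
  | some i =>
    have h := hθ.finCoeff_le i.1 i
    classical
    rw [finCoeff_simple, if_pos rfl] at h
    rw [nodeCoeff_some, zero_add, one_smul]
    omega

theorem IsHighestRoot.gr_delta_pos {J : Set (Node b)} (hJ : J ≠ Set.univ) :
    0 < gr b θ J (0, 1) := by
  classical
  obtain ⟨i, hi⟩ := (Set.ne_univ_iff_exists_notMem J).mp hJ
  refine Finset.sum_pos' (fun j _ => ?_) ⟨i, Finset.mem_univ i, ?_⟩
  · split_ifs
    · rfl
    · exact (hθ.nodeCoeff_delta_pos j).le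
  · rw [if_neg hi]
    exact hθ.nodeCoeff_delta_pos i

theorem IsHighestRoot.period_pos {J : Set (Node b)} (hJ : J ≠ Set.univ) :
    0 < period b θ J := by
  have := hθ.gr_delta_pos hJ
  simp only [period]; omega

theorem IsHighestRoot.gr_eq_add_period {J : Set (Node b)} (hJ : J ≠ Set.univ)
    (β : FinRootLattice H) (r : ℤ) :
    gr b θ J (β, r) = gr b θ J (β, 0) + r * period b θ J := by
  rw [gr_eq, period, Int.toNat_of_nonneg (hθ.gr_delta_pos hJ).le]

/-- If `r > 0`, then `β + r δ` is a nonnegative combination of the simple roots. -/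
theorem IsHighestRoot.nodeCoeff_nonneg_of_pos (α : H.root) {r : ℤ} (hr : 0 < r) (i : Node b) :
    0 ≤ nodeCoeff b θ i (finRoot α, r) := by
  cases i with
  | none => exact hr.le
  | some i =>
    have h := hθ.finCoeff_le (negRoot α) i
    have h2 := hθ.nodeCoeff_delta_pos (some i)
    simp only [finRoot_negRoot, map_neg, nodeCoeff_some, zero_add, one_smul,
      map_add, map_zsmul, smul_eq_mul] at h h2 ⊢
    nlinarith

theorem IsHighestRoot.nodeCoeff_nonneg_or_nonpos (α : H.root) (r : ℤ) :
    (∀ i, 0 ≤ nodeCoeff b θ i (finRoot α, r)) ∨ ∀ i, nodeCoeff b θ i (finRoot α, r) ≤ 0 := by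
  rcases lt_trichotomy r 0 with hr | rfl | hr
  · right
    intro i
    have h := hθ.nodeCoeff_nonneg_of_pos (negRoot α) (r := -r) (by omega) i
    have e : ((finRoot (negRoot α), -r) : AffRootLattice H) = -(finRoot α, r) := rfl
    have e2 := map_neg (nodeCoeffHom b θ i) (finRoot α, r)
    rw [e] at h
    change nodeCoeff b θ i _ = -nodeCoeff b θ i _ at e2
    omega
  · rcases finCoeff_nonneg_or_nonpos b α with h | h
    · left; rintro (_ | i)
      · exact le_rfl
      · simpa [nodeCoeff_some] using h i
    · right; rintro (_ | i)
      · exact le_rfl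
      · simpa [nodeCoeff_some] using h i
  · exact .inl (hθ.nodeCoeff_nonneg_of_pos α hr)

omit hθ in
theorem isPos_of_nodeCoeff_nonneg {α : H.root} (h : ∀ i, 0 ≤ nodeCoeff b θ i (finRoot α, 0)) :
    b.IsPos α := by
  rw [RootPairing.Base.isPos_iff', height_eq_sum_finCoeff]
  exact Finset.sum_nonneg fun i _ => by simpa [nodeCoeff_some] using h (some i)

theorem IsHighestRoot.nodeCoeff_nonneg_of_isPos {α : H.root} (h : b.IsPos α) (i : Node b) :
    0 ≤ nodeCoeff b θ i (finRoot α, 0) := by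
  rcases hθ.nodeCoeff_nonneg_or_nonpos α 0 with h' | h'
  · exact h' i
  · rw [RootPairing.Base.isPos_iff, height_eq_sum_finCoeff] at h
    exact absurd h (not_lt.mpr (Finset.sum_nonpos fun i _ => by
      simpa [nodeCoeff_some] using h' (some i)))

/-- A positive real affine root that is not a simple root, up to multiples of `δ`, stays a
positive root after some affine simple root is subtracted from it. Indeed `γ = ∑ a_i α_i` pairs
to `2` with its coroot, so some `α_i` with `a_i > 0` pairs positively with it. -/
theorem IsHighestRoot.exists_sub_simpleRoot (α : H.root) (r : ℤ)
    (h : ∀ i, 0 ≤ nodeCoeff b θ i (finRoot α, r)) :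
    ∃ i, 0 < nodeCoeff b θ i (finRoot α, r) ∧ (α = nodeRoot b θ i ∨
      ∃ β s, ((finRoot α, r) : AffRootLattice H) = (finRoot β, s) + simpleRoot b θ i ∧
        ∀ j, 0 ≤ nodeCoeff b θ j (finRoot β, s)) := by
  classical
  have hsum := congrArg Prod.fst (sum_nodeCoeff_smul_simpleRoot b θ (finRoot α, r))
  have hpair : ∑ i, nodeCoeff b θ i (finRoot α, r) *
      (IsKilling.rootSystem H).pairingIn ℤ (nodeRoot b θ i) α = 2 := by
    have h1 := congrArg (fun v : FinRootLattice H => (v : Module.Dual ℂ H)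
      ((IsKilling.rootSystem H).coroot α)) hsum
    simp only [Prod.fst_sum, simpleRoot_eq, Prod.smul_fst,
      AddSubmonoidClass.coe_finsetSum, LinearMap.sum_apply] at h1
    have h2 : ∀ β : H.root, ((finRoot β : FinRootLattice H) : Module.Dual ℂ H)
        ((IsKilling.rootSystem H).coroot α) = (((IsKilling.rootSystem H).pairingIn ℤ β α : ℤ) : ℂ) := fun β =>
      ((IsKilling.rootSystem H).algebraMap_pairingIn ℤ β α).symm
    simp only [Submodule.coe_smul, LinearMap.smul_apply, h2, zsmul_eq_mul] at h1
    have h3 : (IsKilling.rootSystem H).pairingIn ℤ α α = 2 := by simp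
    rw [h3] at h1
    exact_mod_cast h1
  obtain ⟨i, -, hi⟩ : ∃ i ∈ Finset.univ,
      0 < nodeCoeff b θ i (finRoot α, r) *
        (IsKilling.rootSystem H).pairingIn ℤ (nodeRoot b θ i) α :=
    Finset.exists_lt_of_sum_lt (f := fun _ => 0) (by rw [hpair]; simp)
  have hc : 0 < nodeCoeff b θ i (finRoot α, r) :=
    lt_of_le_of_ne (h i) fun e => by rw [← e, zero_mul] at hi; exact lt_irrefl _ hi
  have hp : 0 < (IsKilling.rootSystem H).pairingIn ℤ (nodeRoot b θ i) α :=
    (mul_pos_iff_of_pos_left hc).mp hi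
  refine ⟨i, hc, or_iff_not_imp_left.mpr fun hne => ?_⟩
  obtain ⟨β', hβ'⟩ := (IsKilling.rootSystem H).root_sub_root_mem_of_pairingIn_pos hp (Ne.symm hne)
  have hβ : finRoot (negRoot β') = finRoot α - finRoot (nodeRoot b θ i) := by
    ext1
    change -(IsKilling.rootSystem H).root β' =
      (IsKilling.rootSystem H).root α - (IsKilling.rootSystem H).root (nodeRoot b θ i)
    rw [hβ', neg_sub]
  have hγ : ((finRoot α, r) : AffRootLattice H) =
      (finRoot (negRoot β'), r - nodeShift b i) + simpleRoot b θ i := by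
    rw [simpleRoot_eq, hβ, Prod.mk_add_mk, sub_add_cancel, sub_add_cancel]
  refine ⟨negRoot β', r - nodeShift b i, hγ, ?_⟩
  refine (hθ.nodeCoeff_nonneg_or_nonpos _ _).resolve_right fun hneg => ?_
  -- all coefficients but the `i`-th would vanish, and the `i`-th would be one
  have key : ((finRoot α, r) : AffRootLattice H) = simpleRoot b θ i := by
    rw [← sum_nodeCoeff_smul_simpleRoot b θ (finRoot α, r), Finset.sum_eq_single i]
    · have h1 := congrArg (nodeCoeff b θ i) hγ
      rw [nodeCoeff_add, nodeCoeff_simpleRoot, if_pos rfl] at h1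
      have h2 := hneg i
      have : nodeCoeff b θ i (finRoot α, r) = 1 := by omega
      rw [this, one_smul]
    · intro j _ hj
      have h1 := congrArg (nodeCoeff b θ j) hγ
      rw [nodeCoeff_add, nodeCoeff_simpleRoot, if_neg hj] at h1
      have h2 := hneg j
      have h3 := h j
      have : nodeCoeff b θ j (finRoot α, r) = 0 := by omega
      rw [this, zero_smul]
    · simp
  refine hne (finRoot_injective ?_)
  rw [simpleRoot_eq] at key
  exact congrArg Prod.fst key

/-- Induction on the height of a positive real affine root. -/
theorem IsHighestRoot.affine_induction {p : H.root → ℤ → Prop}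
    (simple : ∀ i r, 0 < nodeCoeff b θ i (finRoot (nodeRoot b θ i), r) →
      (∀ j, 0 ≤ nodeCoeff b θ j (finRoot (nodeRoot b θ i), r)) → p (nodeRoot b θ i) r)
    (add : ∀ i α β r s, ((finRoot α, r) : AffRootLattice H) = (finRoot β, s) + simpleRoot b θ i →
      0 < nodeCoeff b θ i (finRoot α, r) → (∀ j, 0 ≤ nodeCoeff b θ j (finRoot α, r)) →
      p β s → p α r)
    (α : H.root) (r : ℤ) (h : ∀ i, 0 ≤ nodeCoeff b θ i (finRoot α, r)) : p α r := by
  classical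
  obtain ⟨n, hn⟩ : ∃ n : ℕ, ∑ i, nodeCoeff b θ i (finRoot α, r) = n :=
    Int.eq_ofNat_of_zero_le (Finset.sum_nonneg fun i _ => h i)
  induction n generalizing α r with
  | zero =>
    obtain ⟨i, hi, -⟩ := hθ.exists_sub_simpleRoot α r h
    have := Finset.sum_pos' (fun j _ => h j) ⟨i, Finset.mem_univ i, hi⟩
    rw [hn] at this
    exact absurd this (by simp)
  | succ n ih =>
    obtain ⟨i, hi, rfl | ⟨β, s, hγ, hβ⟩⟩ := hθ.exists_sub_simpleRoot α r h
    · exact simple i r hi h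
    · refine add i α β r s hγ hi h (ih β s hβ ?_)
      rw [hγ] at hn
      simp only [nodeCoeff_add, Finset.sum_add_distrib, nodeCoeff_simpleRoot,
        Finset.sum_ite_eq', Finset.mem_univ, if_true] at hn
      push_cast at hn
      omega

end AffineRoots

/-! ### The automorphism of Kac type -/

section KacAutomorphism

variable {L : Type*} [LieRing L] [LieAlgebra ℂ L] [FiniteDimensional ℂ L] [IsSimple ℂ L]
  {H : LieSubalgebra ℂ L} [H.IsCartanSubalgebra]

theorem coroot_mem_of_wt_le {S : LieSubalgebra ℂ L} {α : H.root}
    (h : wt (finRoot α) ≤ S.toSubmodule) (h' : wt (-finRoot α) ≤ S.toSubmodule) :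
    ((IsKilling.coroot α.1 : H) : L) ∈ S := by
  have hα := H.isNonZero_coe_root α
  obtain ⟨t, e, f, isSl2, he, hf⟩ := IsKilling.exists_isSl2Triple_of_weight_isNonZero hα
  rw [← isSl2.h_eq_coroot hα he hf, ← isSl2.lie_e_f]
  exact S.lie_mem (h he) (h' hf)

theorem eq_top_of_wt_le {S : LieSubalgebra ℂ L}
    (h : ∀ α : H.root, wt (finRoot α) ≤ S.toSubmodule) : S = ⊤ := by
  have hH : ∀ x ∈ H, x ∈ S := by
    intro x hx
    have hspan : (⟨x, hx⟩ : H) ∈ Submodule.span ℂ (Set.range (IsKilling.rootSystem H).coroot) := by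
      rw [RootPairing.IsRootSystem.span_coroot_eq_top]; trivial
    have hle : Submodule.span ℂ (Set.range (IsKilling.rootSystem H).coroot) ≤
        S.toSubmodule.comap H.toSubmodule.subtype := by
      rw [Submodule.span_le]
      rintro - ⟨α, rfl⟩
      exact coroot_mem_of_wt_le (h α) (h (negRoot α))
    exact hle hspan
  rw [eq_top_iff]
  intro x _
  refine graded_induction (wt_isInternal H) x (fun β y hy => ?_) S.zero_mem
    fun y z hy hz => S.add_mem hy hz
  rcases wt_eq_bot_or β with hβ | rfl | ⟨α, rfl⟩
  · rw [hβ, Submodule.mem_bot] at hy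
    exact hy ▸ S.zero_mem
  · exact hH y (mem_wt_zero.mp hy)
  · exact h α hy

variable {b : (IsKilling.rootSystem H).Base} {θ : H.root} (hθ : IsHighestRoot b θ)

include hθ in
/-- The root spaces of the finite parts of the affine simple roots generate the Lie algebra: every
root `α` has `α + δ` positive, so induction on the height of affine roots reaches it. -/
theorem IsHighestRoot.eq_top_of_nodeRoot_le {S : LieSubalgebra ℂ L}
    (h : ∀ i, wt (finRoot (nodeRoot b θ i)) ≤ S.toSubmodule) : S = ⊤ := by
  refine eq_top_of_wt_le (H := H) fun α => ?_
  refine hθ.affine_induction (p := fun (α : H.root) _ => wt (finRoot α) ≤ S.toSubmodule)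
    (fun i _ _ _ => h i) (fun i α β r s hγ _ _ hβ x hx => ?_) α 1
    (hθ.nodeCoeff_nonneg_of_pos α one_pos)
  rw [simpleRoot_eq] at hγ
  obtain ⟨y, hy, z, hz, rfl⟩ := exists_lie_eq_of_add (congrArg Prod.fst hγ) hx
  exact S.lie_mem (hβ hy) (h i hz)

theorem isKacAutomorphism_iff {J : Set (Node b)} {ξ : ℂ} {σ : L ≃ₗ⁅ℂ⁆ L} :
    IsKacAutomorphism b θ J ξ σ ↔
      ∀ i, ∀ x ∈ wt (finRoot (nodeRoot b θ i)), σ x = ξ ^ kacLabel b J i • x := by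
  constructor
  · rintro h (_ | i) x hx
    · exact h.lowest x hx
    · exact h.simple i x hx
  · intro h
    exact ⟨fun i => h (some i), h none⟩

variable (b θ) in
/-- The linear map that acts on the root space of `β` as `ζ ^ gr_J(β)`. -/
def kacLinear (J : Set (Node b)) (ζ : ℂ) : L →ₗ[ℂ] L :=
  gradedMap (wt_isInternal H) fun β => ζ ^ gr b θ J (β, 0) • LinearMap.id

theorem kacLinear_apply (J : Set (Node b)) (ζ : ℂ) {β : FinRootLattice H} {x : L}
    (hx : x ∈ wt β) : kacLinear b θ J ζ x = ζ ^ gr b θ J (β, 0) • x := by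
  rw [kacLinear, gradedMap_apply _ _ hx]; rfl

theorem kacLinear_lie (J : Set (Node b)) {ζ : ℂ} (hζ : ζ ≠ 0) (x y : L) :
    kacLinear b θ J ζ ⁅x, y⁆ = ⁅kacLinear b θ J ζ x, kacLinear b θ J ζ y⁆ := by
  refine graded_induction (wt_isInternal H) x (fun β x hx => ?_) (by simp)
    fun x x' hx hx' => by simp only [add_lie, map_add, hx, hx']
  refine graded_induction (wt_isInternal H) y (fun γ y hy => ?_) (by simp)
    fun y y' hy hy' => by simp only [lie_add, map_add, hy, hy']
  have h : gr b θ J (β + γ, 0) = gr b θ J (β, 0) + gr b θ J (γ, 0) := by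
    rw [← gr_add, Prod.mk_add_mk, add_zero]
  rw [kacLinear_apply J ζ hx, kacLinear_apply J ζ hy, kacLinear_apply J ζ (lie_mem_wt hx hy), h,
    zpow_add₀ hζ, smul_lie, lie_smul, smul_smul]

theorem kacLinear_inv (J : Set (Node b)) {ζ : ℂ} (hζ : ζ ≠ 0) (x : L) :
    kacLinear b θ J ζ⁻¹ (kacLinear b θ J ζ x) = x := by
  refine graded_induction (wt_isInternal H) x (fun β x hx => ?_) (by simp)
    fun x x' hx hx' => by simp only [map_add, hx, hx']
  rw [kacLinear_apply J ζ hx, map_smul, kacLinear_apply J ζ⁻¹ hx, smul_smul, inv_zpow,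
    mul_inv_cancel₀ (zpow_ne_zero _ hζ), one_smul]

variable (b θ) in
/-- The automorphism that acts on the root space of `β` as `ζ ^ gr_J(β)`. -/
def kacEquiv (J : Set (Node b)) {ζ : ℂ} (hζ : ζ ≠ 0) : L ≃ₗ⁅ℂ⁆ L where
  __ := kacLinear b θ J ζ
  map_lie' := kacLinear_lie J hζ _ _
  invFun := kacLinear b θ J ζ⁻¹
  left_inv := kacLinear_inv J hζ
  right_inv x := by
    have := kacLinear_inv (θ := θ) J (inv_ne_zero hζ) x
    rwa [inv_inv] at this

variable {J : Set (Node b)} (hJ : J ≠ Set.univ) {ξ : ℂ} (hξ : IsPrimitiveRoot ξ (period b θ J))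

include hθ hJ hξ

theorem IsHighestRoot.unityRoot_ne_zero : ξ ≠ 0 := hξ.ne_zero (hθ.period_pos hJ).ne'

/-- Adding `δ` to a weight changes the grade by `m`, which `ξ` does not see. -/
theorem IsHighestRoot.zpow_gr (β : FinRootLattice H) (r : ℤ) :
    ξ ^ gr b θ J (β, r) = ξ ^ gr b θ J (β, 0) := by
  rw [hθ.gr_eq_add_period hJ, zpow_add₀ (hθ.unityRoot_ne_zero hJ hξ), mul_comm r, zpow_mul,
    zpow_natCast, hξ.pow_eq_one, one_zpow, mul_one]

theorem IsHighestRoot.isKacAutomorphism_kacEquiv :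
    IsKacAutomorphism b θ J ξ (kacEquiv b θ J (hθ.unityRoot_ne_zero hJ hξ)) := by
  rw [isKacAutomorphism_iff]
  intro i x hx
  refine (kacLinear_apply J ξ hx).trans ?_
  rw [← hθ.zpow_gr hJ hξ _ (nodeShift b i), ← simpleRoot_eq, gr_simpleRoot, zpow_natCast]

omit hJ hξ in
theorem IsHighestRoot.isKacAutomorphism_unique {σ τ : L ≃ₗ⁅ℂ⁆ L}
    (hσ : IsKacAutomorphism b θ J ξ σ) (hτ : IsKacAutomorphism b θ J ξ τ) : σ = τ := by
  let S : LieSubalgebra ℂ L :=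
    { LinearMap.eqLocus (σ : L →ₗ[ℂ] L) (τ : L →ₗ[ℂ] L) with
      lie_mem' := by
        intro x y hx hy
        change σ ⁅x, y⁆ = τ ⁅x, y⁆
        have hx' : σ x = τ x := hx
        have hy' : σ y = τ y := hy
        rw [LieEquiv.map_lie, LieEquiv.map_lie, hx', hy'] }
  rw [isKacAutomorphism_iff] at hσ hτ
  have hS : S = ⊤ := hθ.eq_top_of_nodeRoot_le fun i x hx =>
    show σ x = τ x from (hσ i x hx).trans (hτ i x hx).symm
  ext x
  have : x ∈ S := hS ▸ LieSubalgebra.mem_top x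
  exact this

theorem IsHighestRoot.existsUnique_isKacAutomorphism :
    ∃! σ : L ≃ₗ⁅ℂ⁆ L, IsKacAutomorphism b θ J ξ σ :=
  ⟨_, hθ.isKacAutomorphism_kacEquiv hJ hξ, fun _ h =>
    hθ.isKacAutomorphism_unique h (hθ.isKacAutomorphism_kacEquiv hJ hξ)⟩

variable {σ : L ≃ₗ⁅ℂ⁆ L} (hσ : IsKacAutomorphism b θ J ξ σ)

include hσ

theorem IsHighestRoot.kac_apply {β : FinRootLattice H} {x : L} (hx : x ∈ wt β) :
    σ x = ξ ^ gr b θ J (β, 0) • x := by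
  rw [hθ.isKacAutomorphism_unique hσ (hθ.isKacAutomorphism_kacEquiv hJ hξ)]
  exact kacLinear_apply J ξ hx

theorem IsHighestRoot.orderOf_kac : orderOf σ.toLinearEquiv = period b θ J := by
  have hpow : ∀ (k : ℕ) (x : L) (c : ℂ), σ x = c • x → (σ.toLinearEquiv ^ k) x = c ^ k • x := by
    intro k x c h
    induction k with
    | zero => simp
    | succ k ih =>
      rw [pow_succ', LinearEquiv.mul_apply, ih, map_smul]
      change c ^ k • σ x = _
      rw [h, smul_smul, pow_succ]
  apply Nat.dvd_antisymm
  · rw [orderOf_dvd_iff_pow_eq_one]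
    ext x
    refine graded_induction (wt_isInternal H) x (fun β x hx => ?_) (by simp)
      fun x x' hx hx' => by rw [map_add, map_add, hx, hx']
    rw [hpow _ _ _ (hθ.kac_apply hJ hξ hσ hx), ← zpow_natCast, zpow_comm, zpow_natCast,
      hξ.pow_eq_one, one_zpow, one_smul]
    rfl
  · obtain ⟨i, hi⟩ := (Set.ne_univ_iff_exists_notMem J).mp hJ
    obtain ⟨x, hx, hx0⟩ := (nodeRoot b θ i).1.exists_ne_zero
    have h := hpow (orderOf σ.toLinearEquiv) x _ (isKacAutomorphism_iff.mp hσ i x hx)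
    rw [pow_orderOf_eq_one, kacLabel, if_neg hi, pow_one] at h
    refine hξ.dvd_of_pow_eq_one _ ?_
    have h' : (ξ ^ orderOf σ.toLinearEquiv - 1) • x = 0 := by
      rw [sub_smul, one_smul, ← h]; exact sub_self x
    exact sub_eq_zero.mp ((smul_eq_zero.mp h').resolve_right hx0)

end KacAutomorphism

/-! ### Coefficients of loops and currents -/

section Coefficients

variable {L M : Type*} [LieRing L] [LieAlgebra ℂ L] [AddCommGroup M] [Module ℂ M]

variable (L) in
/-- A loop as the finitely supported family of its coefficients. -/
def loopFinsupp : Loop L ≃ₗ[ℂ] (ℤ →₀ L) := LoopAlgebra.toFinsupp ℂ ℤ L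

theorem loopFinsupp_loopElt (r : ℤ) (x : L) :
    loopFinsupp L (loopElt r x) = Finsupp.single r x :=
  LoopAlgebra.toFinsupp_single_tmul ℂ ℤ L r x

/-- The linear map on loops with `x ⊗ t ^ r ↦ F r x`. -/
def loopMap (F : ℤ → L →ₗ[ℂ] M) : Loop L →ₗ[ℂ] M :=
  Finsupp.lsum ℂ F ∘ₗ (loopFinsupp L).toLinearMap

@[simp] theorem loopMap_loopElt (F : ℤ → L →ₗ[ℂ] M) (r : ℤ) (x : L) :
    loopMap F (loopElt r x) = F r x := by
  simp [loopMap, loopFinsupp_loopElt]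

theorem loopElt_injective (r : ℤ) : Function.Injective (loopElt r : L → Loop L) := by
  intro x y h
  have := congrArg (loopFinsupp L) h
  rw [loopFinsupp_loopElt, loopFinsupp_loopElt] at this
  exact Finsupp.single_injective r this

variable (L) in
/-- A current as the finitely supported family of its coefficients. -/
def currentFinsupp : Current L ≃ₗ[ℂ] (ℕ →₀ L) :=
  TensorProduct.equivFinsuppOfBasisLeft (Polynomial.basisMonomials ℂ)

theorem currentFinsupp_currentElt (k : ℕ) (x : L) :
    currentFinsupp L (currentElt k x) = Finsupp.single k x := by
  refine (TensorProduct.equivFinsuppOfBasisLeft_apply_tmul _ _ _).trans ?_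
  have h : (Polynomial.basisMonomials ℂ).repr (Polynomial.X ^ k) = Finsupp.single k 1 := by
    rw [← Polynomial.monomial_one_right_eq_X_pow]
    exact (Polynomial.basisMonomials ℂ).repr_self k
  rw [h, Finsupp.mapRange_single, one_smul]

/-- The coefficient of `t ^ k` of a current. -/
def currentCoeff (k : ℕ) : Current L →ₗ[ℂ] L :=
  Finsupp.lapply k ∘ₗ (currentFinsupp L).toLinearMap

theorem currentCoeff_currentElt (j k : ℕ) (x : L) :
    currentCoeff j (currentElt k x) = if k = j then x else 0 := by
  simp [currentCoeff, currentFinsupp_currentElt, Finsupp.single_apply]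

/-- The linear map on currents with `x ⊗ t ^ k ↦ F k x`. -/
def currentMap (F : ℕ → L →ₗ[ℂ] M) : Current L →ₗ[ℂ] M :=
  Finsupp.lsum ℂ F ∘ₗ (currentFinsupp L).toLinearMap

@[simp] theorem currentMap_currentElt (F : ℕ → L →ₗ[ℂ] M) (k : ℕ) (x : L) :
    currentMap F (currentElt k x) = F k x := by
  simp [currentMap, currentFinsupp_currentElt]

theorem exists_eq_sum_currentElt (f : Current L) :
    ∃ s : Finset ℕ, f = ∑ k ∈ s, currentElt k (currentCoeff k f) := by
  refine ⟨(currentFinsupp L f).support, (currentFinsupp L).injective ?_⟩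
  rw [map_sum]
  simp only [currentFinsupp_currentElt]
  exact (Finsupp.sum_single _).symm

@[elab_as_elim]
theorem current_induction {p : Current L → Prop} (f : Current L)
    (elt : ∀ k x, p (currentElt k x)) (add : ∀ f g, p f → p g → p (f + g)) : p f := by
  obtain ⟨s, hs⟩ := exists_eq_sum_currentElt f
  rw [hs]
  refine Finset.sum_induction _ p add ?_ fun k _ => elt k _
  simpa using elt 0 0

theorem current_ext {f g : Current L} (h : ∀ k, currentCoeff k f = currentCoeff k g) : f = g :=
  (currentFinsupp L).injective (Finsupp.ext h)

theorem lie_currentElt (j k : ℕ) (x y : L) :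
    ⁅currentElt j x, currentElt k y⁆ = currentElt (j + k) ⁅x, y⁆ := by
  refine (ExtendScalars.bracket_tmul ℂ ℂ[X] L L _ _ x y).trans ?_
  rw [← pow_add]; rfl

end Coefficients

/-! ### The weight spaces of the parabolic subalgebras -/

section Parabolic

variable {L : Type*} [LieRing L] [LieAlgebra ℂ L] [FiniteDimensional ℂ L] [IsSimple ℂ L]
  {H : LieSubalgebra ℂ L} [H.IsCartanSubalgebra]

variable (θ : H.root) in
/-- The linear map `x ↦ x ⊗ t ^ r` into the affine Lie algebra. -/
def affEltLinear (r : ℤ) : L →ₗ[ℂ] Affine θ :=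
  LinearMap.inl ℂ (Loop L) (ℂ × ℂ) ∘ₗ loopElt r

omit [IsSimple ℂ L] in
theorem affEltLinear_apply (θ : H.root) (r : ℤ) (x : L) :
    affEltLinear θ r x = affElt θ r x := rfl

variable (θ : H.root) in
/-- The projection of the affine Lie algebra to the loop algebra along `c` and `d`. -/
def affLoop : Affine θ →ₗ[ℂ] Loop L := LinearMap.fst ℂ (Loop L) (ℂ × ℂ)

variable (θ : H.root) in
/-- The coefficient of `d`. -/
def affDCoeff : Affine θ →ₗ[ℂ] ℂ :=
  LinearMap.snd ℂ ℂ ℂ ∘ₗ LinearMap.snd ℂ (Loop L) (ℂ × ℂ)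

variable {θ : H.root}

omit [IsSimple ℂ L] in
@[simp] theorem affLoop_affElt (r : ℤ) (x : L) : affLoop θ (affElt θ r x) = loopElt r x := rfl
omit [IsSimple ℂ L] in
@[simp] theorem affLoop_affC : affLoop θ (affC θ) = 0 := rfl
omit [IsSimple ℂ L] in
@[simp] theorem affDCoeff_affD : affDCoeff θ (affD θ) = 1 := rfl
@[simp] theorem affDCoeff_lie (z w : Affine θ) : affDCoeff θ ⁅z, w⁆ = 0 := rfl

@[simp] theorem affC_lie (z : Affine θ) : ⁅affC θ, z⁆ = 0 := by
  rw [affine_bracket]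
  refine Prod.ext ?_ (Prod.ext ?_ rfl)
  · change ⁅(0 : Loop L), z.1⁆ + (0 : ℂ) • loopDeriv L z.1 - z.2.2 • loopDeriv L 0 = 0
    simp
  · change loopCocycle (normalizedForm θ) 0 z.1 = 0
    simp

@[simp] theorem lie_affC (z : Affine θ) : ⁅z, affC θ⁆ = 0 := by
  rw [← lie_skew, affC_lie, neg_zero]

theorem affLoop_lie {z w : Affine θ} (hz : affDCoeff θ z = 0) (hw : affDCoeff θ w = 0) :
    affLoop θ ⁅z, w⁆ = ⁅affLoop θ z, affLoop θ w⁆ := by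
  change ⁅z.1, w.1⁆ + z.2.2 • loopDeriv L w.1 - w.2.2 • loopDeriv L z.1 = _
  have hz' : z.2.2 = 0 := hz
  have hw' : w.2.2 = 0 := hw
  rw [hz', hw', zero_smul, zero_smul, add_zero, sub_zero]; rfl

variable {b : (IsKilling.rootSystem H).Base} {J : Set (Node b)}

/-- The span of `c` and the weight vectors of nonnegative grade. -/
def nonnegPart (b : (IsKilling.rootSystem H).Base) (θ : H.root) (J : Set (Node b)) :
    Submodule ℂ (Affine θ) :=
  Submodule.span ℂ (insert (affC θ)
    {z | ∃ (β : FinRootLattice H) (r : ℤ), 0 ≤ gr b θ J (β, r) ∧ ∃ x ∈ wt β, z = affElt θ r x})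

theorem affC_mem_nonnegPart : affC θ ∈ nonnegPart b θ J :=
  Submodule.subset_span (Set.mem_insert _ _)

theorem affElt_mem_nonnegPart {β : FinRootLattice H} {r : ℤ} (h : 0 ≤ gr b θ J (β, r)) {x : L}
    (hx : x ∈ wt β) : affElt θ r x ∈ nonnegPart b θ J :=
  Submodule.subset_span (Set.mem_insert_of_mem _ ⟨β, r, h, x, hx, rfl⟩)

theorem affDCoeff_of_mem_nonnegPart {z : Affine θ} (hz : z ∈ nonnegPart b θ J) :
    affDCoeff θ z = 0 := by
  have : nonnegPart b θ J ≤ LinearMap.ker (affDCoeff θ) := by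
    rw [nonnegPart, Submodule.span_le]
    rintro z (rfl | ⟨β, r, -, x, -, rfl⟩) <;> rfl
  exact this hz

theorem affC_mem_parabolic : affC θ ∈ parabolic b θ J :=
  LieSubalgebra.subset_lieSpan (.inl (Submodule.subset_span (.inr (.inl rfl))))

theorem affD_mem_parabolic : affD θ ∈ parabolic b θ J :=
  LieSubalgebra.subset_lieSpan (.inl (Submodule.subset_span (.inr (.inr rfl))))

theorem affElt_mem_parabolic_of_pos {r : ℤ} (hr : 0 < r) (x : L) :
    affElt θ r x ∈ parabolic b θ J :=
  LieSubalgebra.subset_lieSpan (.inl (Submodule.subset_span (.inl (.inl (.inl ⟨r, x, hr, rfl⟩)))))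

theorem affElt_mem_parabolic_of_mem_neg {i : Node b} (hi : i ∈ J) {x : L}
    (hx : x ∈ wt (-finRoot (nodeRoot b θ i))) :
    affElt θ (-nodeShift b i) x ∈ parabolic b θ J := by
  refine LieSubalgebra.subset_lieSpan (.inr (Set.mem_iUnion₂.mpr ⟨i, hi, ?_⟩))
  cases i with
  | none =>
    have : x ∈ wt (finRoot θ) := by rwa [nodeRoot, finRoot_negRoot, neg_neg] at hx
    exact ⟨x, this, rfl⟩
  | some i => exact ⟨x, hx, rfl⟩

theorem mem_of_gr_eq_zero {γ : AffRootLattice H} (h : ∀ i, 0 ≤ nodeCoeff b θ i γ)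
    (h0 : gr b θ J γ = 0) {i : Node b} (hi : 0 < nodeCoeff b θ i γ) : i ∈ J := by
  classical
  by_contra hiJ
  have := (Finset.sum_eq_zero_iff_of_nonneg (fun j _ => by
    split_ifs
    · exact le_rfl
    · exact h j)).mp h0 i (Finset.mem_univ i)
  rw [if_neg hiJ] at this
  omega

theorem gr_nonneg_of_nodeCoeff {γ : AffRootLattice H} (h : ∀ i, 0 ≤ nodeCoeff b θ i γ) :
    0 ≤ gr b θ J γ := by
  classical
  refine Finset.sum_nonneg fun i _ => ?_
  split_ifs
  · exact le_rfl
  · exact h i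

theorem gr_simpleRoot_of_mem {i : Node b} (hi : i ∈ J) : gr b θ J (simpleRoot b θ i) = 0 := by
  rw [gr_simpleRoot, kacLabel, if_pos hi]; rfl

theorem gr_zero : gr b θ J 0 = 0 := map_zero (grHom b θ J)

variable (hθ : IsHighestRoot b θ)

section

variable (hJ : J ≠ Set.univ)

include hθ hJ

/-- The negatives of the positive real roots of grade zero belong to the parabolic subalgebra,
by induction on the height. -/
theorem IsHighestRoot.affElt_neg_mem_parabolic (α : H.root) (r : ℤ)
    (h : ∀ i, 0 ≤ nodeCoeff b θ i (finRoot α, r)) (h0 : gr b θ J (finRoot α, r) = 0)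
    {x : L} (hx : x ∈ wt (-finRoot α)) : affElt θ (-r) x ∈ parabolic b θ J := by
  revert x h0
  refine hθ.affine_induction (p := fun (α : H.root) r => gr b θ J (finRoot α, r) = 0 →
    ∀ {x : L}, x ∈ wt (-finRoot α) → affElt θ (-r) x ∈ parabolic b θ J) ?_ ?_ α r h
  · intro i r hi h h0 x hx
    have hiJ := mem_of_gr_eq_zero h h0 hi
    have h1 := gr_simpleRoot_of_mem (θ := θ) hiJ
    rw [simpleRoot_eq, gr_eq] at h1
    rw [gr_eq] at h0
    have h2 : (r - nodeShift b i) * gr b θ J (0, 1) = 0 := by rw [sub_mul]; omega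
    have h3 : r = nodeShift b i := by
      have := (mul_eq_zero.mp h2).resolve_right (hθ.gr_delta_pos hJ).ne'
      omega
    exact h3 ▸ affElt_mem_parabolic_of_mem_neg hiJ hx
  · intro i α β r s hγ hi h ih h0 x hx
    have hiJ := mem_of_gr_eq_zero h h0 hi
    have hs : gr b θ J (finRoot β, s) = 0 := by
      rwa [hγ, gr_add, gr_simpleRoot_of_mem hiJ, add_zero] at h0
    rw [simpleRoot_eq] at hγ
    have hroot : finRoot (negRoot α) =
        finRoot (negRoot β) + finRoot (negRoot (nodeRoot b θ i)) := by
      have := congrArg Prod.fst hγ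
      simp only [finRoot_negRoot] at this ⊢
      rw [this, Prod.mk_add_mk, neg_add]
    obtain ⟨y, hy, z, hz, rfl⟩ := exists_lie_eq_of_add hroot hx
    have hr : -r = -s + -nodeShift b i := by
      have : r = s + nodeShift b i := congrArg Prod.snd hγ
      omega
    have hyz := (parabolic b θ J).lie_mem (ih hs hy) (affElt_mem_parabolic_of_mem_neg hiJ hz)
    rw [lie_affElt, ← hr] at hyz
    have hc := (parabolic b θ J).smul_mem
      (if -r = 0 then ((-s : ℤ) : ℂ) * normalizedForm θ y z else 0)
      (affC_mem_parabolic (b := b) (θ := θ) (J := J))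
    have := (parabolic b θ J).sub_mem hyz hc
    rwa [add_sub_cancel_right] at this

/-- The coefficients of a real affine root all have the same sign, so a root of nonnegative grade is
a root of the Borel subalgebra or the negative of a positive root of grade zero. -/
theorem IsHighestRoot.affElt_mem_parabolic {β : FinRootLattice H} {r : ℤ}
    (h : 0 ≤ gr b θ J (β, r)) {x : L} (hx : x ∈ wt β) : affElt θ r x ∈ parabolic b θ J := by
  rcases lt_or_ge 0 r with hr | hr
  · exact affElt_mem_parabolic_of_pos hr x
  rcases wt_eq_bot_or β with hβ | rfl | ⟨α, rfl⟩
  · rw [hβ, Submodule.mem_bot] at hx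
    rw [hx, ← affEltLinear_apply, map_zero]
    exact zero_mem _
  · have h0 : gr b θ J (0, 0) = 0 := gr_zero
    rw [gr_eq, h0, zero_add] at h
    obtain rfl : r = 0 := le_antisymm hr (nonneg_of_mul_nonneg_left h (hθ.gr_delta_pos hJ))
    exact LieSubalgebra.subset_lieSpan (.inl (Submodule.subset_span
      (.inl (.inl (.inr ⟨x, mem_wt_zero.mp hx, rfl⟩)))))
  · rcases hθ.nodeCoeff_nonneg_or_nonpos α r with hc | hc
    · obtain rfl : r = 0 := le_antisymm hr (hc none)
      exact LieSubalgebra.subset_lieSpan (.inl (Submodule.subset_span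
        (.inl (.inr ⟨α, isPos_of_nodeCoeff_nonneg hc, x, hx, rfl⟩))))
    · have e : ((finRoot (negRoot α), -r) : AffRootLattice H) = -(finRoot α, r) := rfl
      have hc' : ∀ i, 0 ≤ nodeCoeff b θ i (finRoot (negRoot α), -r) := fun i => by
        have := map_neg (nodeCoeffHom b θ i) (finRoot α, r)
        change nodeCoeff b θ i _ = -nodeCoeff b θ i _ at this
        rw [e, this]
        exact neg_nonneg.mpr (hc i)
      have h0 : gr b θ J (finRoot (negRoot α), -r) = 0 := by
        refine le_antisymm ?_ (gr_nonneg_of_nodeCoeff hc')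
        rw [e, gr_neg]; omega
      have := hθ.affElt_neg_mem_parabolic hJ (negRoot α) (-r) hc' h0 (x := x)
        (by rwa [finRoot_negRoot, neg_neg])
      rwa [neg_neg] at this

theorem IsHighestRoot.nonnegPart_le_parabolic :
    nonnegPart b θ J ≤ (parabolic b θ J).toSubmodule := by
  rw [nonnegPart, Submodule.span_le]
  rintro z (rfl | ⟨β, r, h, x, hx, rfl⟩)
  · exact affC_mem_parabolic
  · exact hθ.affElt_mem_parabolic hJ h hx

omit hJ in
theorem IsHighestRoot.affElt_mem_nonnegPart_of_pos {r : ℤ} (hr : 0 < r) (x : L) :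
    affElt θ r x ∈ nonnegPart b θ J := by
  rw [← affEltLinear_apply]
  refine graded_induction (wt_isInternal H) x (fun β x hx => ?_) (by simp)
    fun x y hx hy => by rw [map_add]; exact add_mem hx hy
  rcases wt_eq_bot_or β with hβ | rfl | ⟨α, rfl⟩
  · rw [hβ, Submodule.mem_bot] at hx
    rw [hx, map_zero]
    exact zero_mem _
  · refine affElt_mem_nonnegPart ?_ hx
    have h0 : gr b θ J (0, 0) = 0 := gr_zero
    rw [gr_eq, h0, zero_add]
    exact mul_nonneg hr.le (gr_nonneg_of_nodeCoeff fun i => (hθ.nodeCoeff_delta_pos i).le)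
  · exact affElt_mem_nonnegPart (gr_nonneg_of_nodeCoeff (hθ.nodeCoeff_nonneg_of_pos α hr)) hx

end

theorem lie_mem_nonnegPart {z w : Affine θ} (hz : z ∈ nonnegPart b θ J ⊔ Submodule.span ℂ {affD θ})
    (hw : w ∈ nonnegPart b θ J ⊔ Submodule.span ℂ {affD θ}) : ⁅z, w⁆ ∈ nonnegPart b θ J := by
  rw [nonnegPart, ← Submodule.span_union] at hz hw
  induction hz using Submodule.span_induction with
  | zero => rw [zero_lie]; exact zero_mem _
  | add z z' _ _ hz hz' => rw [add_lie]; exact add_mem hz hz'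
  | smul a z _ hz => rw [smul_lie]; exact Submodule.smul_mem _ _ hz
  | mem z hz =>
    induction hw using Submodule.span_induction with
    | zero => rw [lie_zero]; exact zero_mem _
    | add w w' _ _ hw hw' => rw [lie_add]; exact add_mem hw hw'
    | smul a w _ hw => rw [lie_smul]; exact Submodule.smul_mem _ _ hw
    | mem w hw =>
      rcases hz with (rfl | ⟨β, r, h, x, hx, rfl⟩) | rfl
      · rw [affC_lie]; exact zero_mem _
      · rcases hw with (rfl | ⟨γ, s, h', y, hy, rfl⟩) | rfl
        · rw [lie_affC]; exact zero_mem _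
        · rw [lie_affElt]
          refine add_mem (affElt_mem_nonnegPart ?_ (lie_mem_wt hx hy))
            (Submodule.smul_mem _ _ affC_mem_nonnegPart)
          rw [← Prod.mk_add_mk, gr_add]
          exact add_nonneg h h'
        · rw [← lie_skew, lie_affD_affElt]
          exact neg_mem (Submodule.smul_mem _ _ (affElt_mem_nonnegPart h hx))
      · rcases hw with (rfl | ⟨γ, s, h', y, hy, rfl⟩) | rfl
        · rw [lie_affC]; exact zero_mem _
        · rw [lie_affD_affElt]
          exact Submodule.smul_mem _ _ (affElt_mem_nonnegPart h' hy)
        · rw [lie_self]; exact zero_mem _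

include hθ in
theorem IsHighestRoot.parabolic_le :
    (parabolic b θ J).toSubmodule ≤ nonnegPart b θ J ⊔ Submodule.span ℂ {affD θ} := by
  let S : LieSubalgebra ℂ (Affine θ) :=
    { nonnegPart b θ J ⊔ Submodule.span ℂ {affD θ} with
      lie_mem' := fun hz hw => Submodule.mem_sup_left (lie_mem_nonnegPart hz hw) }
  have hS : parabolic b θ J ≤ S := by
    rw [parabolic, LieSubalgebra.lieSpan_le]
    rintro z (hz | hz)
    · have : borel b θ ≤ S.toSubmodule := by
        rw [borel, Submodule.span_le]
        rintro z (((⟨r, x, hr, rfl⟩ | ⟨x, hx, rfl⟩) | ⟨α, hα, x, hx, rfl⟩) | (rfl | rfl))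
        · exact Submodule.mem_sup_left (hθ.affElt_mem_nonnegPart_of_pos hr x)
        · exact Submodule.mem_sup_left (affElt_mem_nonnegPart (β := 0)
            (le_of_eq (gr_zero (θ := θ) (J := J)).symm) (mem_wt_zero.mpr hx))
        · exact Submodule.mem_sup_left (affElt_mem_nonnegPart
            (gr_nonneg_of_nodeCoeff (hθ.nodeCoeff_nonneg_of_isPos hα)) hx)
        · exact Submodule.mem_sup_left affC_mem_nonnegPart
        · exact Submodule.mem_sup_right (Submodule.mem_span_singleton_self _)
      exact this hz
    · obtain ⟨i, hi, hz⟩ := Set.mem_iUnion₂.mp hz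
      have key : ∀ x ∈ wt (-finRoot (nodeRoot b θ i)),
          affElt θ (-nodeShift b i) x ∈ nonnegPart b θ J := fun x hx => by
        refine affElt_mem_nonnegPart (le_of_eq ?_) hx
        have := gr_neg b θ J (simpleRoot b θ i)
        rw [gr_simpleRoot_of_mem hi, simpleRoot_eq] at this
        exact this.symm
      refine Submodule.mem_sup_left ?_
      cases i with
      | none =>
        obtain ⟨x, hx, rfl⟩ := hz
        exact key x (by rw [nodeRoot, finRoot_negRoot, neg_neg]; exact hx)
      | some i =>
        obtain ⟨x, hx, rfl⟩ := hz
        exact key x hx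
  exact hS

end Parabolic

/-! ### Centralizers in loop and current algebras -/

section Centralizer

variable {L : Type*} [LieRing L] [LieAlgebra ℂ L]

theorem loopFinsupp_lie_loopElt (f : Loop L) (r s : ℤ) (x : L) :
    loopFinsupp L ⁅f, loopElt s x⁆ (r + s) = ⁅loopFinsupp L f r, x⁆ := by
  induction f using loop_induction with
  | add f g hf hg => simp only [add_lie, map_add, Finsupp.add_apply, hf, hg]
  | elt u y =>
    rw [lie_loopElt, loopFinsupp_loopElt, loopFinsupp_loopElt, Finsupp.single_apply,
      Finsupp.single_apply]
    by_cases h : u = r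
    · simp [h]
    · simp [h]

theorem currentCoeff_lie_currentElt (f : Current L) (j k : ℕ) (x : L) :
    currentCoeff (k + j) ⁅f, currentElt j x⁆ = ⁅currentCoeff k f, x⁆ := by
  induction f using current_induction with
  | add f g hf hg => simp only [add_lie, map_add, hf, hg]
  | elt u y =>
    rw [lie_currentElt, currentCoeff_currentElt, currentCoeff_currentElt]
    by_cases h : u = k
    · simp [h]
    · simp [h]

theorem eq_zero_of_forall_lie_eq_zero [FiniteDimensional ℂ L] [IsSimple ℂ L] {x : L}
    (h : ∀ y : L, ⁅x, y⁆ = 0) : x = 0 := by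
  have : x ∈ LieAlgebra.center ℂ L := by
    rw [LieModule.mem_maxTrivSubmodule]
    intro y
    rw [← lie_skew, h, neg_zero]
  rwa [LieAlgebra.center_eq_bot, LieSubmodule.mem_bot] at this

theorem loop_eq_zero_of_lie [FiniteDimensional ℂ L] [IsSimple ℂ L] {f : Loop L} (s : ℤ)
    (h : ∀ x : L, ⁅f, loopElt s x⁆ = 0) : f = 0 := by
  refine (loopFinsupp L).injective ?_
  rw [map_zero]
  ext r
  refine eq_zero_of_forall_lie_eq_zero fun x => ?_
  rw [← loopFinsupp_lie_loopElt f r s x, h, map_zero]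
  rfl

end Centralizer

/-! ### The derived part of the parabolic subalgebra -/

section Derived

variable {L : Type*} [LieRing L] [LieAlgebra ℂ L] [FiniteDimensional ℂ L] [IsSimple ℂ L]
  {H : LieSubalgebra ℂ L} [H.IsCartanSubalgebra] {θ : H.root}

/-- The central term vanishes because its coefficient is `r` when `r + 0 = 0`. -/
theorem lie_affElt_zero (r : ℤ) (x y : L) :
    ⁅affElt θ r x, affElt θ 0 y⁆ = affElt θ r ⁅x, y⁆ := by
  have : (if r + 0 = 0 then (r : ℂ) * normalizedForm θ x y else 0) = 0 := by
    split_ifs with h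
    · rw [add_zero] at h; simp [h]
    · rfl
  rw [lie_affElt, this, zero_smul, add_zero, add_zero]

theorem lie_zero_affElt (r : ℤ) (x y : L) :
    ⁅affElt θ 0 x, affElt θ r y⁆ = affElt θ r ⁅x, y⁆ := by
  have : (if 0 + r = 0 then ((0 : ℤ) : ℂ) * normalizedForm θ x y else 0) = 0 := by simp
  rw [lie_affElt, this, zero_smul, add_zero, zero_add]

theorem normalizedForm_coroot_self :
    normalizedForm θ (IsKilling.coroot θ.1 : H) (IsKilling.coroot θ.1 : H) = 2 := by
  have hθ := H.isNonZero_coe_root θ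
  have h1 := IsKilling.traceForm_coroot θ.1 (IsKilling.coroot θ.1)
  rw [IsKilling.root_apply_coroot hθ] at h1
  have h2 := IsKilling.root_apply_cartanEquivDual_symm_ne_zero hθ
  have h3 : killingForm ℂ L (IsKilling.coroot θ.1 : H) (IsKilling.coroot θ.1 : H) ≠ 0 := by
    have e : killingForm ℂ L (IsKilling.coroot θ.1 : H) (IsKilling.coroot θ.1 : H) =
        LieModule.traceForm ℂ H L (IsKilling.coroot θ.1) (IsKilling.coroot θ.1) := rfl
    rw [e, h1]
    exact smul_ne_zero two_ne_zero (smul_ne_zero (inv_ne_zero h2) two_ne_zero)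
  rw [normalizedForm, LinearMap.smul_apply, LinearMap.smul_apply, smul_eq_mul,
    div_mul_cancel₀ _ h3]

theorem lie_mem_derivedSeries_one (z w : Affine θ) : ⁅z, w⁆ ∈ derivedSeries ℂ (Affine θ) 1 := by
  rw [derivedSeries_def, derivedSeriesOfIdeal_succ, derivedSeriesOfIdeal_zero]
  exact LieSubmodule.lie_mem_lie (LieSubmodule.mem_top z) (LieSubmodule.mem_top w)

theorem affDCoeff_of_mem_derivedSeries {z : Affine θ} (hz : z ∈ derivedSeries ℂ (Affine θ) 1) :
    affDCoeff θ z = 0 := by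
  rw [derivedSeries_def, derivedSeriesOfIdeal_succ, derivedSeriesOfIdeal_zero,
    ← LieSubmodule.mem_toSubmodule, LieSubmodule.lieIdeal_oper_eq_linear_span'] at hz
  have : Submodule.span ℂ {m : Affine θ | ∃ x ∈ (⊤ : LieIdeal ℂ (Affine θ)),
      ∃ n ∈ (⊤ : LieIdeal ℂ (Affine θ)), ⁅x, n⁆ = m} ≤ LinearMap.ker (affDCoeff θ) := by
    rw [Submodule.span_le]
    rintro - ⟨z, -, w, -, rfl⟩
    exact affDCoeff_lie z w
  exact this hz

theorem affElt_mem_derivedSeries (r : ℤ) (x : L) :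
    affElt θ r x ∈ derivedSeries ℂ (Affine θ) 1 := by
  let S : LieSubalgebra ℂ L :=
    { (derivedSeries ℂ (Affine θ) 1).toSubmodule.comap (affEltLinear θ r) with
      lie_mem' := by
        intro x y _ _
        change affElt θ r ⁅x, y⁆ ∈ derivedSeries ℂ (Affine θ) 1
        rw [← lie_affElt_zero]
        exact lie_mem_derivedSeries_one _ _ }
  have hS : S = ⊤ := by
    refine eq_top_of_wt_le (H := H) fun α y hy => ?_
    have h1 := lie_of_mem_wt hy (IsKilling.coroot α.1)
    have h2 : ((finRoot α : FinRootLattice H) : Module.Dual ℂ H) (IsKilling.coroot α.1) = 2 :=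
      IsKilling.root_apply_coroot (H.isNonZero_coe_root α)
    rw [h2] at h1
    have h3 : y = (2⁻¹ : ℂ) • ⁅((IsKilling.coroot α.1 : H) : L), y⁆ := by
      rw [h1, smul_smul, inv_mul_cancel₀ two_ne_zero, one_smul]
    rw [h3]
    refine S.smul_mem _ ?_
    change affElt θ r _ ∈ derivedSeries ℂ (Affine θ) 1
    rw [← lie_affElt_zero]
    exact lie_mem_derivedSeries_one _ _
  have : x ∈ S := hS ▸ LieSubalgebra.mem_top x
  exact this

/-- `[h ⊗ t, h ⊗ t⁻¹] = (h, h) c = 2 c` for `h = θ^∨`. -/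
theorem affC_mem_derivedSeries : affC θ ∈ derivedSeries ℂ (Affine θ) 1 := by
  set h : L := ((IsKilling.coroot θ.1 : H) : L)
  have h1 := lie_affElt (θ := θ) 1 (-1) h h
  rw [lie_self, ← affEltLinear_apply _ _ 0, map_zero, zero_add, if_pos (by norm_num),
    normalizedForm_coroot_self] at h1
  have h2 : affC θ = (2⁻¹ : ℂ) • ⁅affElt θ 1 h, affElt θ (-1) h⁆ := by
    rw [h1, smul_smul]; norm_num
  rw [h2]
  exact Submodule.smul_mem _ _ (lie_mem_derivedSeries_one _ _)

variable {b : (IsKilling.rootSystem H).Base} {J : Set (Node b)} (hθ : IsHighestRoot b θ)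
  (hJ : J ≠ Set.univ)

include hθ hJ in
theorem IsHighestRoot.derivedParabolic_eq :
    (derivedParabolic b θ J).toSubmodule = nonnegPart b θ J := by
  refine le_antisymm ?_ ?_
  · rintro z ⟨hz, hz'⟩
    have h0 := affDCoeff_of_mem_derivedSeries hz'
    obtain ⟨w, hw, v, hv, rfl⟩ := Submodule.mem_sup.mp (hθ.parabolic_le hz)
    obtain ⟨a, rfl⟩ := Submodule.mem_span_singleton.mp hv
    rw [map_add, affDCoeff_of_mem_nonnegPart hw, map_smul, affDCoeff_affD, zero_add, smul_eq_mul,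
      mul_one] at h0
    rwa [h0, zero_smul, add_zero]
  · intro z hz
    refine ⟨hθ.nonnegPart_le_parabolic hJ hz, ?_⟩
    have : nonnegPart b θ J ≤ (derivedSeries ℂ (Affine θ) 1).toSubmodule := by
      rw [nonnegPart, Submodule.span_le]
      rintro z (rfl | ⟨β, r, -, x, -, rfl⟩)
      · exact affC_mem_derivedSeries
      · exact affElt_mem_derivedSeries r x
    exact this hz

include hθ hJ in
theorem IsHighestRoot.mem_derivedParabolic {z : Affine θ} :
    z ∈ derivedParabolic b θ J ↔ z ∈ nonnegPart b θ J := by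
  rw [← LieSubalgebra.mem_toSubmodule, hθ.derivedParabolic_eq hJ]

/-- The projection of the loops to the weight vectors of negative grade. -/
def negLoop (b : (IsKilling.rootSystem H).Base) (θ : H.root) (J : Set (Node b)) :
    Loop L →ₗ[ℂ] Loop L :=
  loopMap fun r => gradedMap (wt_isInternal H) fun β =>
    (if 0 ≤ gr b θ J (β, r) then (0 : ℂ) else 1) • loopElt r

theorem negLoop_loopElt {β : FinRootLattice H} {x : L} (hx : x ∈ wt β) (r : ℤ) :
    negLoop b θ J (loopElt r x) =
      (if 0 ≤ gr b θ J (β, r) then (0 : ℂ) else 1) • loopElt r x := by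
  rw [negLoop, loopMap_loopElt, gradedMap_apply _ _ hx, LinearMap.smul_apply]

/-- A nonzero weight vector that occurs in the span of the weight vectors of nonnegative grade has
itself nonnegative grade. -/
theorem gr_nonneg_of_affElt_mem {β : FinRootLattice H} {r : ℤ} {x : L} (hx : x ∈ wt β)
    (hx0 : x ≠ 0) (h : affElt θ r x ∈ nonnegPart b θ J) : 0 ≤ gr b θ J (β, r) := by
  by_contra hneg
  have h1 : negLoop b θ J (loopElt r x) = 0 := by
    have hle : nonnegPart b θ J ≤ LinearMap.ker (negLoop b θ J ∘ₗ affLoop θ) := by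
      rw [nonnegPart, Submodule.span_le]
      rintro z (rfl | ⟨γ, s, h, y, hy, rfl⟩)
      · rw [SetLike.mem_coe, LinearMap.mem_ker, LinearMap.comp_apply, affLoop_affC, map_zero]
      · rw [SetLike.mem_coe, LinearMap.mem_ker, LinearMap.comp_apply, affLoop_affElt,
          negLoop_loopElt hy, if_pos h, zero_smul]
    have := LinearMap.mem_ker.mp (hle h)
    rwa [LinearMap.comp_apply, affLoop_affElt] at this
  rw [negLoop_loopElt hx, if_neg hneg, one_smul] at h1
  exact hx0 (loopElt_injective r (h1.trans (map_zero (loopElt r)).symm))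

/-! ### Regrading the loops -/

/-- The linear map on loops with `x ⊗ t ^ r ↦ x ⊗ t ^ gr_J(β + r δ)` for `x` of weight `β`; its
values at weight vectors of negative grade are irrelevant. -/
def regradeLoop (b : (IsKilling.rootSystem H).Base) (θ : H.root) (J : Set (Node b)) :
    Loop L →ₗ[ℂ] Current L :=
  loopMap fun r => gradedMap (wt_isInternal H) fun β => currentElt (gr b θ J (β, r)).toNat

theorem regradeLoop_loopElt {β : FinRootLattice H} {x : L} (hx : x ∈ wt β) (r : ℤ) :
    regradeLoop b θ J (loopElt r x) = currentElt (gr b θ J (β, r)).toNat x := by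
  rw [regradeLoop, loopMap_loopElt, gradedMap_apply _ _ hx]

theorem regradeLoop_lie {z w : Affine θ} (hz : z ∈ nonnegPart b θ J)
    (hw : w ∈ nonnegPart b θ J) : regradeLoop b θ J (affLoop θ ⁅z, w⁆) =
      ⁅regradeLoop b θ J (affLoop θ z), regradeLoop b θ J (affLoop θ w)⁆ := by
  rw [affLoop_lie (affDCoeff_of_mem_nonnegPart hz) (affDCoeff_of_mem_nonnegPart hw)]
  induction hz using Submodule.span_induction with
  | zero => simp
  | add z z' _ _ hz hz' => simp only [map_add, add_lie, hz, hz']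
  | smul a z _ hz => simp only [map_smul, smul_lie, hz]
  | mem z hz =>
    induction hw using Submodule.span_induction with
    | zero => simp
    | add w w' _ _ hw hw' => simp only [map_add, lie_add, hw, hw']
    | smul a w _ hw => simp only [map_smul, lie_smul, hw]
    | mem w hw =>
      rcases hz with rfl | ⟨β, r, h, x, hx, rfl⟩
      · simp
      rcases hw with rfl | ⟨γ, s, h', y, hy, rfl⟩
      · simp
      rw [affLoop_affElt, affLoop_affElt, lie_loopElt, regradeLoop_loopElt (lie_mem_wt hx hy),
        regradeLoop_loopElt hx, regradeLoop_loopElt hy, lie_currentElt, ← Prod.mk_add_mk, gr_add,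
        Int.toNat_add h h']

include hθ hJ in
/-- The exponent of `t` is recovered from the grade, as `m > 0`. -/
theorem IsHighestRoot.affLoop_eq_zero_of_regradeLoop {z : Affine θ} (hz : z ∈ nonnegPart b θ J)
    (h0 : regradeLoop b θ J (affLoop θ z) = 0) : affLoop θ z = 0 := by
  -- the left inverse `x ⊗ t ^ k ↦ x ⊗ t ^ ((k - gr_J(β)) / m)`
  let U : Current L →ₗ[ℂ] Loop L := currentMap fun k => gradedMap (wt_isInternal H) fun β =>
    loopElt ((k - gr b θ J (β, 0)) / gr b θ J (0, 1))
  have hU : nonnegPart b θ J ≤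
      LinearMap.eqLocus (U ∘ₗ regradeLoop b θ J ∘ₗ affLoop θ) (affLoop θ) := by
    rw [nonnegPart, Submodule.span_le]
    rintro z (rfl | ⟨β, r, h, x, hx, rfl⟩)
    · change U (regradeLoop b θ J (affLoop θ (affC θ))) = affLoop θ (affC θ)
      simp
    · change U (regradeLoop b θ J (affLoop θ (affElt θ r x))) = affLoop θ (affElt θ r x)
      rw [affLoop_affElt, regradeLoop_loopElt hx, currentMap_currentElt, gradedMap_apply _ _ hx,
        Int.toNat_of_nonneg h, gr_eq, add_sub_cancel_left,
        Int.mul_ediv_cancel _ (hθ.gr_delta_pos hJ).ne']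
  have : U (regradeLoop b θ J (affLoop θ z)) = affLoop θ z := hU hz
  rw [← this, h0, map_zero]

/-- The Lie algebra homomorphism `x ⊗ t ^ r ↦ x ⊗ t ^ gr_J(β + r δ)`. -/
def regradeHom (hθ : IsHighestRoot b θ) (hJ : J ≠ Set.univ) :
    derivedParabolic b θ J →ₗ⁅ℂ⁆ Current L where
  __ := regradeLoop b θ J ∘ₗ affLoop θ ∘ₗ (derivedParabolic b θ J).toSubmodule.subtype
  map_lie' {z w} :=
    regradeLoop_lie ((hθ.mem_derivedParabolic hJ).mp z.2) ((hθ.mem_derivedParabolic hJ).mp w.2)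

theorem regradeHom_apply (z : derivedParabolic b θ J) :
    regradeHom hθ hJ z = regradeLoop b θ J (affLoop θ z) := rfl

theorem regradeHom_affElt {β : FinRootLattice H} {r : ℤ} {x : L} (hx : x ∈ wt β)
    (h : affElt θ r x ∈ derivedParabolic b θ J) :
    regradeHom hθ hJ ⟨affElt θ r x, h⟩ = currentElt (gr b θ J (β, r)).toNat x := by
  rw [regradeHom_apply, affLoop_affElt, regradeLoop_loopElt hx]

theorem regradeHom_eq_zero_iff (z : derivedParabolic b θ J) :
    regradeHom hθ hJ z = 0 ↔ affLoop θ z = 0 := by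
  rw [regradeHom_apply]
  refine ⟨hθ.affLoop_eq_zero_of_regradeLoop hJ ((hθ.mem_derivedParabolic hJ).mp z.2), fun h => ?_⟩
  rw [h, map_zero]

omit hθ hJ in
theorem mem_center_of_eq_smul_affC {z : derivedParabolic b θ J} {a : ℂ}
    (hz : (z : Affine θ) = a • affC θ) :
    z ∈ LieAlgebra.center ℂ (derivedParabolic b θ J) := by
  rw [LieModule.mem_maxTrivSubmodule]
  intro w
  refine Subtype.ext ?_
  change ⁅(w : Affine θ), (z : Affine θ)⁆ = 0
  rw [hz, lie_smul, lie_affC, smul_zero]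

/-- The kernel is `ℂ c`. Conversely, a central element commutes with `L ⊗ t`, which lies in the
parabolic subalgebra, so that its loop part vanishes. -/
theorem ker_regradeHom :
    (regradeHom hθ hJ).ker = LieAlgebra.center ℂ (derivedParabolic b θ J) := by
  ext z
  rw [LieHom.mem_ker, regradeHom_eq_zero_iff]
  have hd : ∀ w : derivedParabolic b θ J, affDCoeff θ w = 0 := fun w =>
    affDCoeff_of_mem_nonnegPart ((hθ.mem_derivedParabolic hJ).mp w.2)
  constructor
  · intro h
    refine mem_center_of_eq_smul_affC (a := (z : Affine θ).2.1) ?_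
    refine Prod.ext ?_ (Prod.ext ?_ ?_)
    · change affLoop θ z = _ • (0 : Loop L)
      rw [h, smul_zero]
    · change _ = _ * (1 : ℂ)
      rw [mul_one]
    · change affDCoeff θ z = _ * (0 : ℂ)
      rw [hd, mul_zero]
  · intro h
    rw [LieModule.mem_maxTrivSubmodule] at h
    refine loop_eq_zero_of_lie 1 fun x => ?_
    have hx : affElt θ 1 x ∈ derivedParabolic b θ J :=
      (hθ.mem_derivedParabolic hJ).mpr (hθ.affElt_mem_nonnegPart_of_pos one_pos x)
    have h1 : ⁅affElt θ 1 x, (z : Affine θ)⁆ = 0 := congrArg Subtype.val (h ⟨_, hx⟩)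
    rw [← lie_skew, neg_eq_zero] at h1
    have h2 := congrArg (affLoop θ) h1
    rwa [affLoop_lie (hd z) rfl, affLoop_affElt, map_zero] at h2

end Derived

/-! ### The twisted current algebra -/

section Twisted

variable {L : Type*} [LieRing L] [LieAlgebra ℂ L] {ξ : ℂ} {σ : L ≃ₗ⁅ℂ⁆ L}

theorem currentCoeff_currentHom (f : Current L) (k : ℕ) :
    currentCoeff k (currentHom ξ σ f) = ξ⁻¹ ^ k • σ (currentCoeff k f) := by
  induction f using current_induction with
  | add f g hf hg => simp only [map_add, hf, hg, smul_add]
  | elt j x =>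
    rw [currentHom_currentElt, map_smul, currentCoeff_currentElt, currentCoeff_currentElt]
    by_cases h : j = k
    · simp [h]
    · simp [h]

theorem mem_twistedCurrent_iff (hξ : ξ ≠ 0) {f : Current L} :
    f ∈ twistedCurrent ξ σ ↔ ∀ k, σ (currentCoeff k f) = ξ ^ k • currentCoeff k f := by
  have h : ∀ k, ξ⁻¹ ^ k • σ (currentCoeff k f) = currentCoeff k f ↔
      σ (currentCoeff k f) = ξ ^ k • currentCoeff k f := fun k => by
    rw [inv_pow, inv_smul_eq_iff₀ (pow_ne_zero k hξ)]
  simp only [← h, ← currentCoeff_currentHom]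
  exact ⟨fun hf k => congrArg _ hf, fun hf => current_ext hf⟩

theorem currentElt_mem_twistedCurrent_iff (hξ : ξ ≠ 0) {k : ℕ} {x : L} :
    currentElt k x ∈ twistedCurrent ξ σ ↔ σ x = ξ ^ k • x := by
  rw [mem_twistedCurrent_iff hξ]
  constructor
  · intro h
    simpa [currentCoeff_currentElt] using h k
  · intro h j
    rw [currentCoeff_currentElt]
    split_ifs with hj
    · rw [← hj, h]
    · rw [map_zero, smul_zero]

theorem currentElt_currentCoeff_mem (hξ : ξ ≠ 0) {f : Current L} (hf : f ∈ twistedCurrent ξ σ)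
    (k : ℕ) : currentElt k (currentCoeff k f) ∈ twistedCurrent ξ σ :=
  (currentElt_mem_twistedCurrent_iff hξ).mpr ((mem_twistedCurrent_iff hξ).mp hf k)

theorem isLieGrading_twistedPiece (hξ : ξ ≠ 0) : IsLieGrading (twistedPiece ξ σ) := by
  refine ⟨DirectSum.isInternal_submodule_of_iSupIndep_of_iSup_eq_top ?_ ?_, ?_⟩
  · refine iSupIndep_of_separating
      (fun k => currentCoeff k ∘ₗ (twistedCurrent ξ σ).toSubmodule.subtype) ?_ ?_
    · rintro k f ⟨x, hx⟩ h0
      replace hx : currentElt k x = (f : Current L) := hx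
      replace h0 : currentCoeff k (f : Current L) = 0 := h0
      rw [← hx, currentCoeff_currentElt, if_pos rfl] at h0
      rw [h0, map_zero] at hx
      exact Subtype.ext hx.symm
    · rintro j k hjk f ⟨x, hx⟩
      replace hx : currentElt j x = (f : Current L) := hx
      change currentCoeff k (f : Current L) = 0
      rw [← hx, currentCoeff_currentElt, if_neg hjk]
  · rw [eq_top_iff]
    intro f _
    obtain ⟨s, hs⟩ := exists_eq_sum_currentElt (f : Current L)
    have hf : f = ∑ k ∈ s, ⟨_, currentElt_currentCoeff_mem hξ f.2 k⟩ := by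
      refine Subtype.ext ?_
      rw [AddSubmonoidClass.coe_finsetSum]
      exact hs
    rw [hf]
    exact Submodule.sum_mem _ fun k _ => Submodule.mem_iSup_of_mem k ⟨_, rfl⟩
  · rintro j k f ⟨x, hx⟩ g ⟨y, hy⟩
    replace hx : currentElt j x = (f : Current L) := hx
    replace hy : currentElt k y = (g : Current L) := hy
    refine ⟨⁅x, y⁆, ?_⟩
    change _ = ⁅(f : Current L), (g : Current L)⁆
    rw [← hx, ← hy, lie_currentElt]

variable [FiniteDimensional ℂ L] [IsSimple ℂ L] {H : LieSubalgebra ℂ L} [H.IsCartanSubalgebra]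
  {b : (IsKilling.rootSystem H).Base} {θ : H.root} {J : Set (Node b)} (hθ : IsHighestRoot b θ)
  (hJ : J ≠ Set.univ) (hξ : IsPrimitiveRoot ξ (period b θ J))
  (hσ : IsKacAutomorphism b θ J ξ σ)

include hθ hJ hξ hσ

theorem IsHighestRoot.currentElt_gr_mem {β : FinRootLattice H} {r : ℤ}
    (h : 0 ≤ gr b θ J (β, r)) {x : L} (hx : x ∈ wt β) :
    currentElt (gr b θ J (β, r)).toNat x ∈ twistedCurrent ξ σ := by
  rw [currentElt_mem_twistedCurrent_iff (hθ.unityRoot_ne_zero hJ hξ), hθ.kac_apply hJ hξ hσ hx,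
    ← hθ.zpow_gr hJ hξ β r, ← zpow_natCast, Int.toNat_of_nonneg h]

/-- The `ξ ^ k`-eigenspace of `σ` is the sum of the root spaces of the `β` such that
`gr_J(β + r δ) = k` for some `r`. -/
theorem IsHighestRoot.mem_span_of_kac_eq {k : ℕ} {x : L} (hx : σ x = ξ ^ k • x) :
    x ∈ Submodule.span ℂ
      {y | ∃ (β : FinRootLattice H) (r : ℤ), gr b θ J (β, r) = k ∧ y ∈ wt β} := by
  have h0 := hθ.unityRoot_ne_zero hJ hξ
  obtain ⟨s, hs⟩ := exists_sum_gradedComp (wt_isInternal H) x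
  rw [hs]
  refine Submodule.sum_mem _ fun β _ => ?_
  set y := gradedComp (wt_isInternal H) β x with hy
  have hyβ : y ∈ wt β := gradedComp_mem _ β x
  by_cases hy0 : y = 0
  · rw [hy0]; exact zero_mem _
  have hcomm : ∀ z, gradedComp (wt_isInternal H) β (σ z) =
      ξ ^ gr b θ J (β, 0) • gradedComp (wt_isInternal H) β z := fun z => by
    refine graded_induction (wt_isInternal H) z (fun γ z hz => ?_) (by simp)
      fun z z' hz hz' => by simp only [map_add, hz, hz', smul_add]
    rw [hθ.kac_apply hJ hξ hσ hz, map_smul, gradedComp_of_mem _ hz]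
    split_ifs with h
    · rw [h]
    · simp
  have h1 := hcomm x
  rw [hx, map_smul, ← hy, ← sub_eq_zero, ← sub_smul] at h1
  have h2 := sub_eq_zero.mp ((smul_eq_zero.mp h1).resolve_right hy0)
  have h3 : ξ ^ ((k : ℤ) - gr b θ J (β, 0)) = 1 := by
    rw [zpow_sub₀ h0, zpow_natCast, h2, div_self (zpow_ne_zero _ h0)]
  obtain ⟨r, hr⟩ := (hξ.zpow_eq_one_iff_dvd _).mp h3
  refine Submodule.subset_span ⟨β, r, ?_, hyβ⟩
  rw [hθ.gr_eq_add_period hJ, mul_comm]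
  omega

theorem range_regradeHom : (regradeHom hθ hJ).range = twistedCurrent ξ σ := by
  have h0 := hθ.unityRoot_ne_zero hJ hξ
  refine le_antisymm ?_ ?_
  · rintro - ⟨z, rfl⟩
    have hle : nonnegPart b θ J ≤
        (twistedCurrent ξ σ).toSubmodule.comap (regradeLoop b θ J ∘ₗ affLoop θ) := by
      rw [nonnegPart, Submodule.span_le]
      rintro z (rfl | ⟨β, r, h, x, hx, rfl⟩)
      · rw [SetLike.mem_coe, Submodule.mem_comap, LinearMap.comp_apply, affLoop_affC, map_zero]
        exact zero_mem _
      · rw [SetLike.mem_coe, Submodule.mem_comap, LinearMap.comp_apply, affLoop_affElt,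
          regradeLoop_loopElt hx]
        exact hθ.currentElt_gr_mem hJ hξ hσ h hx
    exact hle ((hθ.mem_derivedParabolic hJ).mp z.2)
  · intro f hf
    obtain ⟨s, hs⟩ := exists_eq_sum_currentElt f
    rw [hs]
    refine sum_mem fun k _ => ?_
    have hk := hθ.mem_span_of_kac_eq hJ hξ hσ ((mem_twistedCurrent_iff h0).mp hf k)
    have hle : Submodule.span ℂ
        {y : L | ∃ (β : FinRootLattice H) (r : ℤ), gr b θ J (β, r) = k ∧ y ∈ wt β} ≤
        (regradeHom hθ hJ).range.toSubmodule.comap (currentElt k) := by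
      rw [Submodule.span_le]
      rintro y ⟨β, r, hr, hy⟩
      have hmem : affElt θ r y ∈ derivedParabolic b θ J :=
        (hθ.mem_derivedParabolic hJ).mpr (affElt_mem_nonnegPart (by omega) hy)
      refine ⟨⟨_, hmem⟩, (regradeHom_affElt hθ hJ hy hmem).trans ?_⟩
      rw [hr, Int.toNat_natCast]
    exact hle hk

end Twisted

/-! ### The graded isomorphism -/

/-- The first isomorphism theorem with prescribed kernel and range. -/
theorem exists_lieEquiv_of_ker_of_range {A B : Type*} [LieRing A] [LieAlgebra ℂ A] [LieRing B]
    [LieAlgebra ℂ B] (f : A →ₗ⁅ℂ⁆ B) {I : LieIdeal ℂ A} {S : LieSubalgebra ℂ B}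
    (hI : f.ker = I) (hS : f.range = S) :
    ∃ e : (A ⧸ I) ≃ₗ⁅ℂ⁆ S, ∀ x : A, (e (LieSubmodule.Quotient.mk x) : B) = f x := by
  subst hI hS
  exact ⟨f.quotKerEquivRange, fun x => rfl⟩

section Isomorphism

variable {L : Type*} [LieRing L] [LieAlgebra ℂ L] [FiniteDimensional ℂ L] [IsSimple ℂ L]
  {H : LieSubalgebra ℂ L} [H.IsCartanSubalgebra] {b : (IsKilling.rootSystem H).Base} {θ : H.root}
  {J : Set (Node b)} {ξ : ℂ} {σ : L ≃ₗ⁅ℂ⁆ L} (hθ : IsHighestRoot b θ) (hJ : J ≠ Set.univ)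

theorem toReduced_surjective : Function.Surjective (toReduced b θ J) :=
  LieSubmodule.Quotient.surjective_mk' _

theorem toReduced_lie (z w : derivedParabolic b θ J) :
    toReduced b θ J ⁅z, w⁆ = ⁅toReduced b θ J z, toReduced b θ J w⁆ := rfl

section

variable (hξ : IsPrimitiveRoot ξ (period b θ J)) (hσ : IsKacAutomorphism b θ J ξ σ)
  (φ : ReducedParabolic b θ J ≃ₗ⁅ℂ⁆ twistedCurrent ξ σ)
  (hφ : ∀ z, (φ (toReduced b θ J z) : Current L) = regradeHom hθ hJ z)

include hφ

theorem regradesWeight_of_apply (β : FinRootLattice H) :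
    RegradesWeight b θ J ξ σ (φ : _ →ₗ[ℂ] _) β := fun _ _ hx hx0 h =>
  ⟨gr_nonneg_of_affElt_mem hx hx0 ((hθ.mem_derivedParabolic hJ).mp h),
    (hφ _).trans (regradeHom_affElt hθ hJ hx h)⟩

include hξ hσ

theorem map_reducedPiece (k : ℕ) :
    (reducedPiece b θ J k).map (φ : _ →ₗ[ℂ] _) = twistedPiece ξ σ k := by
  refine le_antisymm ?_ ?_
  · rw [Submodule.map_le_iff_le_comap, reducedPiece, Submodule.span_le]
    rintro - ⟨β, r, hr, x, hx, h, rfl⟩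
    refine ⟨x, ?_⟩
    refine Eq.trans ?_ ((hφ _).trans (regradeHom_affElt hθ hJ hx h)).symm
    rw [hr, Int.toNat_natCast]
  · rintro f ⟨x, hx⟩
    replace hx : currentElt k x = (f : Current L) := hx
    have hk := (currentElt_mem_twistedCurrent_iff (hθ.unityRoot_ne_zero hJ hξ)).mp (hx ▸ f.2)
    have hle : Submodule.span ℂ
        {y : L | ∃ (β : FinRootLattice H) (r : ℤ), gr b θ J (β, r) = k ∧ y ∈ wt β} ≤
        (((reducedPiece b θ J k).map (φ : _ →ₗ[ℂ] _)).map
          (twistedCurrent ξ σ).toSubmodule.subtype).comap (currentElt k) := by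
      rw [Submodule.span_le]
      rintro y ⟨β, r, hr, hy⟩
      have hmem : affElt θ r y ∈ derivedParabolic b θ J :=
        (hθ.mem_derivedParabolic hJ).mpr (affElt_mem_nonnegPart (by omega) hy)
      refine ⟨_, ⟨toReduced b θ J ⟨_, hmem⟩, Submodule.subset_span ⟨β, r, hr, y, hy, hmem, rfl⟩,
        rfl⟩, ((hφ _).trans (regradeHom_affElt hθ hJ hy hmem)).trans ?_⟩
      rw [hr, Int.toNat_natCast]
    obtain ⟨g, hg, hgf⟩ := hle (hθ.mem_span_of_kac_eq hJ hξ hσ hk)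
    have : g = f := Subtype.ext (hgf.trans hx)
    exact this ▸ hg

/-- The grading is transported along the isomorphism. -/
theorem isLieGrading_reducedPiece : IsLieGrading (reducedPiece b θ J) := by
  obtain ⟨h1, h2⟩ := isLieGrading_twistedPiece (σ := σ) (hθ.unityRoot_ne_zero hJ hξ)
  have hmap := map_reducedPiece hθ hJ hξ hσ φ hφ
  have hcomap : ∀ k, reducedPiece b θ J k =
      (twistedPiece ξ σ k).comap (φ.toLinearEquiv : _ →ₗ[ℂ] _) := fun k => by
    rw [← hmap k]
    exact (Submodule.comap_map_eq_of_injective φ.injective _).symm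
  have hfun : reducedPiece b θ J =
      (Submodule.orderIsoMapComap φ.toLinearEquiv).symm ∘ twistedPiece ξ σ := funext hcomap
  have hmem : ∀ k x, x ∈ reducedPiece b θ J k ↔ φ x ∈ twistedPiece ξ σ k := fun k x => by
    rw [hcomap k]; rfl
  refine ⟨DirectSum.isInternal_submodule_of_iSupIndep_of_iSup_eq_top ?_ ?_, ?_⟩
  · rw [hfun]
    exact (iSupIndep_map_orderIso_iff _).mpr h1.submodule_iSupIndep
  · rw [hfun]
    refine (OrderIso.map_iSup (Submodule.orderIsoMapComap φ.toLinearEquiv).symm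
      (twistedPiece ξ σ)).symm.trans ?_
    rw [h1.submodule_iSup_eq_top, OrderIso.map_top]
  · intro i j x hx y hy
    rw [hmem] at hx hy ⊢
    rw [LieEquiv.map_lie]
    exact h2 i j _ hx _ hy

end

end Isomorphism

/-! ### Uniqueness of the isomorphism -/

section Uniqueness

variable {L : Type*} [LieRing L] [LieAlgebra ℂ L] [FiniteDimensional ℂ L] [IsSimple ℂ L]
  {H : LieSubalgebra ℂ L} [H.IsCartanSubalgebra] {b : (IsKilling.rootSystem H).Base} {θ : H.root}
  {J : Set (Node b)} {ξ : ℂ} {σ : L ≃ₗ⁅ℂ⁆ L} (hθ : IsHighestRoot b θ) (hJ : J ≠ Set.univ)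

theorem eq_zero_of_forall_lie_wt_eq_zero {x : L}
    (h : ∀ α : H.root, ∀ y ∈ wt (finRoot α), ⁅x, y⁆ = 0) : x = 0 := by
  let S : LieSubalgebra ℂ L :=
    { LinearMap.ker (LieAlgebra.ad ℂ L x) with
      lie_mem' := by
        intro y z hy hz
        have hy' : ⁅x, y⁆ = 0 := hy
        have hz' : ⁅x, z⁆ = 0 := hz
        change ⁅x, ⁅y, z⁆⁆ = 0
        rw [leibniz_lie, hy', hz', zero_lie, lie_zero, add_zero] }
  have hS : S = ⊤ := eq_top_of_wt_le (H := H) fun α y hy => h α y hy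
  refine eq_zero_of_forall_lie_eq_zero fun y => ?_
  have : y ∈ S := hS ▸ LieSubalgebra.mem_top y
  exact this

theorem toReduced_eq_zero_of_eq_smul_affC {z : derivedParabolic b θ J} {a : ℂ}
    (hz : (z : Affine θ) = a • affC θ) : toReduced b θ J z = 0 := by
  exact (Submodule.Quotient.mk_eq_zero _).mpr (mem_center_of_eq_smul_affC hz)

theorem RegradesWeight.apply_eq {φ ψ : ReducedParabolic b θ J →ₗ[ℂ] twistedCurrent ξ σ}
    {β : FinRootLattice H} (hφ : RegradesWeight b θ J ξ σ φ β)
    (hψ : RegradesWeight b θ J ξ σ ψ β) {r : ℤ} {x : L} (hx : x ∈ wt β)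
    (h : affElt θ r x ∈ derivedParabolic b θ J) :
    ψ (toReduced b θ J ⟨affElt θ r x, h⟩) = φ (toReduced b θ J ⟨affElt θ r x, h⟩) := by
  by_cases hx0 : x = 0
  · have : toReduced b θ J ⟨affElt θ r x, h⟩ = 0 :=
      toReduced_eq_zero_of_eq_smul_affC (a := 0) (by
        rw [zero_smul]
        change affElt θ r x = 0
        rw [hx0, ← affEltLinear_apply, map_zero])
    rw [this, map_zero, map_zero]
  · exact Subtype.ext ((hψ r x hx hx0 h).2.trans (hφ r x hx hx0 h).2.symm)

include hθ hJ in
/-- An isomorphism is determined by its values on the real root vectors: the values of two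
candidates at a vector `h ⊗ t ^ r`, with `h` in the Cartan subalgebra, have the same brackets with
root vectors `x ⊗ t ^ j` for all roots, so that their difference vanishes. -/
theorem lieEquiv_eq_of_regradesWeight
    (φ ψ : ReducedParabolic b θ J ≃ₗ⁅ℂ⁆ twistedCurrent ξ σ)
    (hφ : ∀ α : H.root, RegradesWeight b θ J ξ σ (φ : _ →ₗ[ℂ] _) (finRoot α))
    (hψ : ∀ α : H.root, RegradesWeight b θ J ξ σ (ψ : _ →ₗ[ℂ] _) (finRoot α)) : ψ = φ := by
  have hroot : ∀ (α : H.root) (r : ℤ), ∀ x ∈ wt (finRoot α),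
      ∀ h : affElt θ r x ∈ derivedParabolic b θ J,
      ψ (toReduced b θ J ⟨affElt θ r x, h⟩) = φ (toReduced b θ J ⟨affElt θ r x, h⟩) :=
    fun α r x hx h => (hφ α).apply_eq (hψ α) hx h
  have hcartan : ∀ (r : ℤ), 0 ≤ r → ∀ x ∈ wt (0 : FinRootLattice H),
      ∀ h : affElt θ r x ∈ derivedParabolic b θ J,
      ψ (toReduced b θ J ⟨affElt θ r x, h⟩) = φ (toReduced b θ J ⟨affElt θ r x, h⟩) := by
    intro r hr x hx h
    set y := toReduced b θ J ⟨affElt θ r x, h⟩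
    rw [← sub_eq_zero]
    refine Subtype.ext (current_ext fun k => ?_)
    rw [ZeroMemClass.coe_zero, map_zero]
    refine eq_zero_of_forall_lie_wt_eq_zero (H := H) fun α z hz => ?_
    by_cases hz0 : z = 0
    · rw [hz0, lie_zero]
    have hzmem : affElt θ 1 z ∈ derivedParabolic b θ J :=
      (hθ.mem_derivedParabolic hJ).mpr (hθ.affElt_mem_nonnegPart_of_pos one_pos z)
    have hwmem : affElt θ (r + 1) ⁅x, z⁆ ∈ derivedParabolic b θ J :=
      (hθ.mem_derivedParabolic hJ).mpr (hθ.affElt_mem_nonnegPart_of_pos (by omega) _)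
    have hw : ⁅x, z⁆ ∈ wt (finRoot α) := by
      have := lie_mem_wt hx hz
      rwa [zero_add] at this
    set v := toReduced b θ J ⟨affElt θ 1 z, hzmem⟩
    have hyv : ⁅y, v⁆ = toReduced b θ J ⟨affElt θ (r + 1) ⁅x, z⁆, hwmem⟩ := by
      rw [← toReduced_lie, ← sub_eq_zero, ← map_sub]
      refine toReduced_eq_zero_of_eq_smul_affC
        (a := if r + 1 = 0 then (r : ℂ) * normalizedForm θ x z else 0) ?_
      change ⁅affElt θ r x, affElt θ 1 z⁆ - affElt θ (r + 1) ⁅x, z⁆ = _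
      rw [lie_affElt, add_sub_cancel_left]
    have h1 : ⁅ψ y - φ y, φ v⁆ = 0 := by
      rw [sub_lie, ← LieEquiv.map_lie, hyv, ← hroot α (r + 1) _ hw hwmem, ← hyv,
        LieEquiv.map_lie, hroot α 1 z hz hzmem, sub_self]
    have h2 : ⁅((ψ y - φ y : twistedCurrent ξ σ) : Current L), (φ v : Current L)⁆ = 0 :=
      congrArg Subtype.val h1
    have h3 : (φ v : Current L) = currentElt (gr b θ J (finRoot α, 1)).toNat z :=
      (hφ α 1 z hz hz0 hzmem).2
    rw [h3] at h2
    rw [← currentCoeff_lie_currentElt, h2, map_zero]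
  have hle : nonnegPart b θ J ≤ (LinearMap.eqLocus
      ((ψ : ReducedParabolic b θ J →ₗ[ℂ] twistedCurrent ξ σ) ∘ₗ toReduced b θ J)
      ((φ : ReducedParabolic b θ J →ₗ[ℂ] twistedCurrent ξ σ) ∘ₗ toReduced b θ J)).map
      (derivedParabolic b θ J).toSubmodule.subtype := by
    rw [nonnegPart, Submodule.span_le]
    rintro z (rfl | ⟨β, r, h, x, hx, rfl⟩)
    · have hc : affC θ ∈ derivedParabolic b θ J :=
        (hθ.mem_derivedParabolic hJ).mpr affC_mem_nonnegPart
      refine ⟨⟨_, hc⟩, ?_, rfl⟩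
      change ψ (toReduced b θ J ⟨_, hc⟩) = φ (toReduced b θ J ⟨_, hc⟩)
      rw [toReduced_eq_zero_of_eq_smul_affC (a := 1) (one_smul ℂ _).symm, map_zero, map_zero]
    · have hmem := (hθ.mem_derivedParabolic hJ).mpr (affElt_mem_nonnegPart h hx)
      refine ⟨⟨_, hmem⟩, ?_, rfl⟩
      change ψ (toReduced b θ J ⟨_, hmem⟩) = φ (toReduced b θ J ⟨_, hmem⟩)
      rcases wt_eq_bot_or β with hβ | rfl | ⟨α, rfl⟩
      · rw [hβ, Submodule.mem_bot] at hx
        rw [toReduced_eq_zero_of_eq_smul_affC (a := 0)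
          (by rw [zero_smul]; change affElt θ r x = 0; rw [hx, ← affEltLinear_apply, map_zero]),
          map_zero, map_zero]
      · have h0 : gr b θ J (0, 0) = 0 := gr_zero
        rw [gr_eq, h0, zero_add] at h
        exact hcartan r (nonneg_of_mul_nonneg_left h (hθ.gr_delta_pos hJ)) x hx hmem
      · exact hroot α r x hx hmem
  refine LieEquiv.ext fun y => ?_
  obtain ⟨z, rfl⟩ := toReduced_surjective y
  obtain ⟨z', hz', hzz'⟩ := hle ((hθ.mem_derivedParabolic hJ).mp z.2)
  have : z' = z := Subtype.ext hzz'
  exact this ▸ hz'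

end Uniqueness

/-! ### The maximal parabolic subalgebras -/

section Maximal

variable {L : Type*} [LieRing L] [LieAlgebra ℂ L] [FiniteDimensional ℂ L] [IsSimple ℂ L]
  {H : LieSubalgebra ℂ L} [H.IsCartanSubalgebra] {b : (IsKilling.rootSystem H).Base} {θ : H.root}
  {J : Set (Node b)} (hθ : IsHighestRoot b θ)

include hθ in
/-- All affine simple roots but one have finite parts whose coroots span the Cartan subalgebra,
since `δ` has nonzero coefficients and finite part zero. -/
theorem IsHighestRoot.span_coroot_nodeRoot_eq_top {i₀ : Node b} (hi₀ : ∀ i, i ≠ i₀ → i ∈ J) :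
    Submodule.span ℂ
      {h : H | ∃ i ∈ J, h = IsKilling.coroot (nodeRoot b θ i).1} = ⊤ := by
  classical
  by_contra hne
  obtain ⟨f, hf0, hf⟩ := Submodule.exists_le_ker_of_lt_top _ (lt_top_iff_ne_top.mpr hne)
  set h := (IsKilling.cartanEquivDual H).symm f with hh
  have hfh : f = IsKilling.cartanEquivDual H h := by rw [hh, LinearEquiv.apply_symm_apply]
  have hJ0 : ∀ i ∈ J, (nodeRoot b θ i).1 h = 0 := by
    intro i hi
    have h1 : LieModule.traceForm ℂ H L h (IsKilling.coroot (nodeRoot b θ i).1) = 0 := by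
      have h1 : f (IsKilling.coroot (nodeRoot b θ i).1) = 0 :=
        hf (Submodule.subset_span ⟨i, hi, rfl⟩)
      rw [hfh] at h1
      exact h1
    rw [LieModule.traceForm_comm, IsKilling.traceForm_coroot] at h1
    have h2 := IsKilling.root_apply_cartanEquivDual_symm_ne_zero
      (H.isNonZero_coe_root (nodeRoot b θ i))
    exact (((smul_eq_zero.mp h1).resolve_left two_ne_zero) |> smul_eq_zero.mp).resolve_left
      (inv_ne_zero h2)
  have hall : ∀ i, (nodeRoot b θ i).1 h = 0 := by
    have hsum := congrArg Prod.fst (sum_nodeCoeff_smul_simpleRoot b θ (0, 1))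
    have h1 := congrArg (fun v : FinRootLattice H => (v : Module.Dual ℂ H) h) hsum
    simp only [Prod.fst_sum, simpleRoot_eq, Prod.smul_fst, AddSubmonoidClass.coe_finsetSum,
      LinearMap.sum_apply, Submodule.coe_smul, LinearMap.smul_apply] at h1
    rw [Finset.sum_eq_single i₀] at h1
    · have h2 : nodeCoeff b θ i₀ (0, 1) • (nodeRoot b θ i₀).1 h = 0 := h1
      have h3 := (smul_eq_zero.mp h2).resolve_left (hθ.nodeCoeff_delta_pos i₀).ne'
      intro i
      by_cases hi : i = i₀
      · exact hi ▸ h3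
      · exact hJ0 i (hi₀ i hi)
    · intro i _ hi
      have : ((finRoot (nodeRoot b θ i) : FinRootLattice H) : Module.Dual ℂ H) h = 0 :=
        hJ0 i (hi₀ i hi)
      rw [this, smul_zero]
    · simp
  have hdual : ∀ g : Module.Dual ℂ H, g h = 0 := by
    have hspan : Submodule.span ℂ ((IsKilling.rootSystem H).root '' b.support) = ⊤ := by
      rw [b.span_root_support]
      exact RootPairing.IsRootSystem.span_root_eq_top
    have hle : Submodule.span ℂ ((IsKilling.rootSystem H).root '' b.support) ≤
        LinearMap.ker (LinearMap.applyₗ (R := ℂ) (M₂ := ℂ) h) := by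
      rw [Submodule.span_le]
      rintro - ⟨i, hi, rfl⟩
      exact hall (some ⟨i, hi⟩)
    intro g
    exact hle (hspan ▸ Submodule.mem_top)
  have h0 : h = 0 := (Module.forall_dual_apply_eq_zero_iff ℂ h).mp hdual
  rw [h0, map_zero] at hfh
  exact hf0 hfh

theorem exists_forall_ne_mem (hcard : J.ncard = b.support.card) :
    ∃ i₀ : Node b, ∀ i, i ≠ i₀ → i ∈ J := by
  classical
  have h1 := Set.ncard_add_ncard_compl J
  rw [Nat.card_eq_fintype_card, Fintype.card_option, Fintype.card_coe, hcard] at h1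
  obtain ⟨i₀, h⟩ := Set.ncard_eq_one.mp (show Jᶜ.ncard = 1 by omega)
  refine ⟨i₀, fun i hi => ?_⟩
  by_contra hiJ
  have : i ∈ ({i₀} : Set (Node b)) := h ▸ hiJ
  exact hi this

include hθ in
theorem IsHighestRoot.derivedParabolic_eq_of_ncard (hJ : J ≠ Set.univ)
    (hcard : J.ncard = b.support.card) :
    (derivedParabolic b θ J).toSubmodule =
      Submodule.span ℂ {z | ∃ x ∈ parabolic b θ J, ∃ y ∈ parabolic b θ J, z = ⁅x, y⁆} ⊔
        Submodule.span ℂ {affC θ} := by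
  have hc : affC θ ∈ Submodule.span ℂ {z | ∃ x ∈ parabolic b θ J,
      ∃ y ∈ parabolic b θ J, z = ⁅x, y⁆} ⊔ Submodule.span ℂ {affC θ} :=
    Submodule.mem_sup_right (Submodule.mem_span_singleton_self _)
  have hlie : ∀ x ∈ parabolic b θ J, ∀ y ∈ parabolic b θ J,
      ⁅x, y⁆ ∈ Submodule.span ℂ {z | ∃ x ∈ parabolic b θ J,
        ∃ y ∈ parabolic b θ J, z = ⁅x, y⁆} ⊔ Submodule.span ℂ {affC θ} := fun x hx y hy =>
    Submodule.mem_sup_left (Submodule.subset_span ⟨x, hx, y, hy, rfl⟩)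
  set T := Submodule.span ℂ {z | ∃ x ∈ parabolic b θ J, ∃ y ∈ parabolic b θ J, z = ⁅x, y⁆} ⊔
    Submodule.span ℂ {affC θ} with hT
  rw [hθ.derivedParabolic_eq hJ]
  refine le_antisymm ?_ ?_
  · have hcartan : ∀ h : H, affElt θ 0 (h : L) ∈ T := by
      obtain ⟨i₀, hi₀⟩ := exists_forall_ne_mem hcard
      have hle : Submodule.span ℂ {h : H | ∃ i ∈ J, h = IsKilling.coroot (nodeRoot b θ i).1} ≤
          T.comap (affEltLinear θ 0 ∘ₗ H.toSubmodule.subtype) := by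
        rw [Submodule.span_le]
        rintro - ⟨i, hi, rfl⟩
        change affElt θ 0 ((IsKilling.coroot (nodeRoot b θ i).1 : H) : L) ∈ T
        have hα := H.isNonZero_coe_root (nodeRoot b θ i)
        obtain ⟨t, e, f, isSl2, he, hf⟩ := IsKilling.exists_isSl2Triple_of_weight_isNonZero hα
        have he' : affElt θ (nodeShift b i) e ∈ parabolic b θ J := by
          refine hθ.affElt_mem_parabolic hJ (β := finRoot (nodeRoot b θ i)) ?_ he
          rw [← simpleRoot_eq, gr_simpleRoot_of_mem hi]
        have hf' := affElt_mem_parabolic_of_mem_neg (θ := θ) hi (x := f) hf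
        have h1 := hlie _ he' _ hf'
        rw [lie_affElt, add_neg_cancel, isSl2.lie_e_f, isSl2.h_eq_coroot hα he hf] at h1
        have h2 := T.sub_mem h1 (T.smul_mem (if (0 : ℤ) = 0 then
          (nodeShift b i : ℂ) * normalizedForm θ e f else 0) hc)
        rwa [add_sub_cancel_right] at h2
      intro h
      exact hle (hθ.span_coroot_nodeRoot_eq_top hi₀ ▸ Submodule.mem_top)
    rw [nonnegPart, Submodule.span_le]
    rintro z (rfl | ⟨β, r, h, x, hx, rfl⟩)
    · exact hc
    have hp := hθ.affElt_mem_parabolic hJ h hx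
    by_cases hr : r = 0
    · subst hr
      rcases wt_eq_bot_or β with hβ | rfl | ⟨α, rfl⟩
      · rw [hβ, Submodule.mem_bot] at hx
        rw [hx, ← affEltLinear_apply, map_zero]
        exact T.zero_mem
      · exact hcartan ⟨x, mem_wt_zero.mp hx⟩
      · have h1 := lie_of_mem_wt hx (IsKilling.coroot α.1)
        have h2 : ((finRoot α : FinRootLattice H) : Module.Dual ℂ H) (IsKilling.coroot α.1) = 2 :=
          IsKilling.root_apply_coroot (H.isNonZero_coe_root α)
        have hcor : affElt θ 0 ((IsKilling.coroot α.1 : H) : L) ∈ parabolic b θ J :=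
          hθ.affElt_mem_parabolic hJ (β := 0) (le_of_eq gr_zero.symm)
            (mem_wt_zero.mpr (IsKilling.coroot α.1).2)
        have h3 := hlie _ hcor _ hp
        rw [lie_zero_affElt, h1, h2, ← affEltLinear_apply, map_smul] at h3
        exact (T.smul_mem_iff two_ne_zero).mp h3
    · have h1 := hlie _ affD_mem_parabolic _ hp
      rw [lie_affD_affElt] at h1
      exact (T.smul_mem_iff (Int.cast_ne_zero.mpr hr)).mp h1
  · refine sup_le ?_ ?_
    · rw [Submodule.span_le]
      rintro - ⟨x, hx, y, hy, rfl⟩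
      exact lie_mem_nonnegPart (hθ.parabolic_le hx) (hθ.parabolic_le hy)
    · rw [Submodule.span_singleton_le_iff_mem]
      exact affC_mem_nonnegPart

end Maximal

end AffineParabolic

end

theorem mainTheorem8 {L : Type*} [LieRing L] [LieAlgebra ℂ L] [FiniteDimensional ℂ L]
    [LieAlgebra.IsSimple ℂ L] (H : LieSubalgebra ℂ L) [H.IsCartanSubalgebra]
    (b : (LieAlgebra.IsKilling.rootSystem H).Base)
    (θ : H.root) (hθ : AffineParabolic.IsHighestRoot b θ)
    (J : Set (AffineParabolic.Node b)) (hJ : J ≠ Set.univ)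
    (ξ : ℂ) (hξ : IsPrimitiveRoot ξ (AffineParabolic.period b θ J)) :
    -- the automorphism `σ` of Kac type exists, is unique, and has order `m`
    (∃! σ : L ≃ₗ⁅ℂ⁆ L, AffineParabolic.IsKacAutomorphism b θ J ξ σ) ∧
    0 < AffineParabolic.period b θ J ∧
    ∀ σ : L ≃ₗ⁅ℂ⁆ L, AffineParabolic.IsKacAutomorphism b θ J ξ σ →
      orderOf σ.toLinearEquiv = AffineParabolic.period b θ J ∧
      -- both sides are graded Lie algebras
      AffineParabolic.IsLieGrading (AffineParabolic.reducedPiece b θ J) ∧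
      AffineParabolic.IsLieGrading (AffineParabolic.twistedPiece ξ σ) ∧
      -- if `J` has `n` elements, then `𝔭_J ∩ [𝔤, 𝔤] = [𝔭_J, 𝔭_J] + ℂ c`
      (J.ncard = b.support.card →
        (AffineParabolic.derivedParabolic b θ J).toSubmodule =
          Submodule.span ℂ {z | ∃ x ∈ AffineParabolic.parabolic b θ J,
            ∃ y ∈ AffineParabolic.parabolic b θ J, z = ⁅x, y⁆} ⊔
          Submodule.span ℂ {AffineParabolic.affC θ}) ∧
      -- the map on root vectors defines a graded isomorphism
      ∃ φ : AffineParabolic.ReducedParabolic b θ J ≃ₗ⁅ℂ⁆ AffineParabolic.twistedCurrent ξ σ,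
        (∀ α : H.root, AffineParabolic.RegradesWeight b θ J ξ σ (φ : _ →ₗ[ℂ] _)
          (AffineParabolic.finRoot α)) ∧
        AffineParabolic.RegradesWeight b θ J ξ σ (φ : _ →ₗ[ℂ] _) 0 ∧
        (∀ k : ℕ, (AffineParabolic.reducedPiece b θ J k).map (φ : _ →ₗ[ℂ] _) =
          AffineParabolic.twistedPiece ξ σ k) ∧
        -- and it is the only isomorphism with these values on the root vectors
        ∀ ψ : AffineParabolic.ReducedParabolic b θ J ≃ₗ⁅ℂ⁆ AffineParabolic.twistedCurrent ξ σ,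
          (∀ α : H.root, AffineParabolic.RegradesWeight b θ J ξ σ (ψ : _ →ₗ[ℂ] _)
            (AffineParabolic.finRoot α)) → ψ = φ := by
  obtain ⟨σ₀, hσ₀, hσ₀'⟩ := hθ.existsUnique_isKacAutomorphism hJ hξ
  refine ⟨⟨σ₀, hσ₀, hσ₀'⟩, hθ.period_pos hJ, fun σ hσ => ?_⟩
  obtain ⟨φ, hφ⟩ := AffineParabolic.exists_lieEquiv_of_ker_of_range
    (AffineParabolic.regradeHom hθ hJ) (AffineParabolic.ker_regradeHom hθ hJ)
    (AffineParabolic.range_regradeHom hθ hJ hξ hσ)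
  have hreg := AffineParabolic.regradesWeight_of_apply hθ hJ φ hφ
  exact ⟨hθ.orderOf_kac hJ hξ hσ,
    AffineParabolic.isLieGrading_reducedPiece hθ hJ hξ hσ φ hφ,
    AffineParabolic.isLieGrading_twistedPiece (hθ.unityRoot_ne_zero hJ hξ),
    hθ.derivedParabolic_eq_of_ncard hJ, φ, fun α => hreg _, hreg _,
    AffineParabolic.map_reducedPiece hθ hJ hξ hσ φ hφ,
    fun ψ hψ => AffineParabolic.lieEquiv_eq_of_regradesWeight hθ hJ φ ψ (fun α => hreg _) hψ⟩
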